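/- Let $k$ be a field and let $A=(A,n)$ be a Hurwitz algebra over $k$, i.e. a non-zero finite-dimensional, unital, not necessarily associative $k$-algebra with a quadratic form $n$ satisfying $n(xy)=n(x)n(y)$ whose polar form $\langle x,y\rangle=n(x+y)-n(x)-n(y)$ is non-degenerate. For $a\in A$ put $L_a(x)=ax$ and $R_a(x)=xa$. For $\alpha,\beta\in GL(A)$ let $A_{\alpha,\beta}$ be the vector space $A$ with the multiplication $x\circ y=\alpha(x)\beta(y)$. Let $GO(A)$ be the group of similitudes of $(A,n)$, i.e. of the $\varphi\in GL(A)$ such that $n(\varphi(x))=\mu(\varphi)n(x)$ for all $x$, with $\mu(\varphi)\in k$ independent of $x$; when $\dim A$ is even, let $GO^+(A)$ be the subgroup of proper similitudes, i.e. those with $\det\varphi=\mu(\varphi)^{\dim A/2}$ if $\operatorname{char}k\neq 2$, and those with Dickson invariant $0$ if $\operatorname{char}k=2$. Put $G(A)=GO(A)$ if $\dim A\le 2$ and $G(A)=GO^+(A)$ if $\dim A\ge 4$. Triality components of $\varphi\in GO(A)$ are maps $\varphi_1,\varphi_2\in GO(A)$ with $\varphi(xy)=\varphi_1(x)\varphi_2(y)$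 for all $x,y\in A$. 1. Every $\varphi\in G(A)$ has triality components $\varphi_1,\varphi_2\in G(A)$. For any triality components $\varphi_1,\varphi_2$ of $\varphi\in G(A)$, the maps $R_{\varphi_2(1)}$ and $L_{\varphi_1(1)}$ are invertible, $\varphi_1=R_{\varphi_2(1)}^{-1}\varphi$, $\varphi_2=L_{\varphi_1(1)}^{-1}\varphi$, and for all $\alpha,\beta\in GL(A)$ the map $\varphi$ is an isomorphism of algebras $A_{\alpha,\beta}\to A_{\gamma,\delta}$, where $$\gamma=\varphi_1\alpha\varphi^{-1}=R_{\varphi_2(1)}^{-1}\varphi\alpha\varphi^{-1},\qquad \delta=\varphi_2\beta\varphi^{-1}=L_{\varphi_1(1)}^{-1}\varphi\beta\varphi^{-1}.$$ 2. Conversely, for all $\alpha,\beta,\gamma,\delta\in GL(A)$, every isomorphism $A_{\alpha,\beta}\to A_{\gamma,\delta}$ lies in $G(A)$. In particular, if $\dim A\ge 4$, then an improper similitude (an element of $GO(A)\setminus GO^+(A)$) is never an isomorphism $A_{\alpha,\beta}\to A_{\gamma,\delta}$. -/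

import Mathlib

namespace HurwitzIsotope

variable {k A : Type*} [Field k]

section Quadratic

variable [AddCommGroup A] [Module k A]

/-- `φ` is a similitude of the quadratic space `(A, n)` with multiplier `μ`. -/
def HasMultiplier (n : QuadraticForm k A) (φ : A ≃ₗ[k] A) (μ : k) : Prop :=
  ∀ x, n (φ x) = μ * n x

/-- The similitudes of `(A, n)`. -/
def GO (n : QuadraticForm k A) : Set (A ≃ₗ[k] A) :=
  {φ | ∃ μ : k, HasMultiplier n φ μ}

/-- In characteristic two: the similitude `φ` has Dickson invariant `d`.
Choose a (not necessarily symmetric) bilinear form `B` with `B x x = n x`. If `μ` is the multiplier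
of `φ`, then `B (φ x) (φ y) - μ B x y` is alternating, hence equals `r x y - r y x` for a bilinear
form `r`. Write `r x y = ⟨T x, y⟩` with `⟨ , ⟩` the polar form of `n`; the Dickson invariant is
`μ⁻¹ tr T`, which lies in `{0, 1}` and does not depend on the choices of `B` and `r`.
(In matrices, with `a`, `w = a + aᵗ` and `r` the Gram matrices of `B`, of the polar form and of `r`,
it is `μ⁻¹ tr (w⁻¹ r)` where `gᵗ a g - μ a = r - rᵗ`.) -/
def HasDicksonInvariant (n : QuadraticForm k A) (φ : A ≃ₗ[k] A) (d : k) : Prop :=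
  ∃ (μ : k) (B : LinearMap.BilinForm k A) (T : Module.End k A),
    HasMultiplier n φ μ ∧
    (∀ x, B x x = n x) ∧
    (∀ x y, B (φ x) (φ y) - μ * B x y =
      QuadraticMap.polar n (T x) y - QuadraticMap.polar n (T y) x) ∧
    LinearMap.trace k A T = μ * d

/-- The proper similitudes of an even-dimensional quadratic space `(A, n)`: those with
`det φ = μ(φ) ^ (dim A / 2)` if `char k ≠ 2`, and those with Dickson invariant zero
if `char k = 2`. -/
def GOPlus (n : QuadraticForm k A) : Set (A ≃ₗ[k] A) :=
  {φ | φ ∈ GO n ∧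
    (ringChar k ≠ 2 → ∃ μ : k, HasMultiplier n φ μ ∧
      LinearMap.det (φ : A →ₗ[k] A) = μ ^ (Module.finrank k A / 2)) ∧
    (ringChar k = 2 → HasDicksonInvariant n φ 0)}

open Classical in
/-- The group `G(A)`: all similitudes if `dim A ≤ 2`, the proper similitudes otherwise. -/
noncomputable def G (n : QuadraticForm k A) : Set (A ≃ₗ[k] A) :=
  if Module.finrank k A ≤ 2 then GO n else GOPlus n

/-- The isomorphisms from the algebra `(A, m)` to the algebra `(A, m')`, where `m` and `m'` are
bilinear multiplications on the vector space `A`. -/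
def Iso (m m' : A →ₗ[k] A →ₗ[k] A) : Set (A ≃ₗ[k] A) :=
  {φ | ∀ x y, φ (m x y) = m' (φ x) (φ y)}

end Quadratic

variable [NonAssocRing A] [Module k A] [IsScalarTower k A A] [SMulCommClass k A A]

/-- A non-zero unital, not necessarily associative, `k`-algebra `A` is a Hurwitz algebra with
norm `n`: the quadratic form `n` is multiplicative and its polar form is non-degenerate. -/
structure IsHurwitz (n : QuadraticForm k A) : Prop where
  nontrivial : Nontrivial A
  nondegenerate : ∀ x, (∀ y, QuadraticMap.polar n x y = 0) → x = 0
  norm_mul : ∀ x y, n (x * y) = n x * n y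

/-- The multiplication `x ∘ y = α(x) β(y)` of the principal isotope `A_{α,β}`. -/
def isotope (α β : A ≃ₗ[k] A) : A →ₗ[k] A →ₗ[k] A :=
  (LinearMap.mul k A).compl₁₂ (α : A →ₗ[k] A) (β : A →ₗ[k] A)

/-- `φ₁, φ₂` are triality components of `φ`. -/
def IsTriality (n : QuadraticForm k A) (φ φ₁ φ₂ : A ≃ₗ[k] A) : Prop :=
  φ₁ ∈ GO n ∧ φ₂ ∈ GO n ∧ ∀ x y, φ (x * y) = φ₁ x * φ₂ y

end HurwitzIsotope

/-!
The group `G(A)` is the group of all `φ ∈ GL(A)` that occur in an autotopy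
`φ(xy) = φ₁(x) φ₂(y)`; setting `x = 1` or `y = 1` expresses `φ₁` and `φ₂` by `φ` and a
multiplication. Such a `φ` is a similitude because the multiplication determines the norm. The
Moufang identities make `L_a` and `R_a` autotopic whenever `n(a) ≠ 0`. Every similitude is some
`L_a` times a product of reflections (Cartan–Dieudonné), and the reflection along `s` is a scalar
multiple of `R_s L_s κ`, where `κ` is the canonical involution; hence a product of `i` reflections
is autotopic up to the factor `κ ^ i`. If `dim A ≤ 2`, then `A` is commutative and `κ` is an
automorphism. If `dim A ≥ 4`, then `L_a` is proper, so that the determinant or the Dickson invariant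
gives the parity of `i`, while `κ` is not autotopic: otherwise `A` would be commutative, but its
centre is `k`.
-/

namespace HurwitzIsotope

open QuadraticMap (polar)
open Module (finrank)
open LinearMap (BilinForm)

section QuadraticSpace

variable {k V : Type*} [Field k] [AddCommGroup V] [Module k V] {n : QuadraticForm k V}
  {φ ψ σ : V ≃ₗ[k] V} {μ ν : k}

theorem map_sub_eq (n : QuadraticForm k V) (x y : V) : n (x - y) = n x + n y - polar n x y := by
  rw [sub_eq_add_neg, QuadraticMap.map_add n, QuadraticMap.map_neg, QuadraticMap.polar_neg_right]
  ring

theorem map_smul_eq (n : QuadraticForm k V) (c : k) (x : V) : n (c • x) = c ^ 2 * n x := by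
  rw [QuadraticMap.map_smul, smul_eq_mul, sq]

theorem polar_self_eq (n : QuadraticForm k V) (x : V) : polar n x x = 2 * n x := by
  rw [QuadraticMap.polar_self, two_nsmul, two_mul]

theorem polarBilin_isSymm (n : QuadraticForm k V) : n.polarBilin.IsSymm :=
  ⟨fun x y => QuadraticMap.polar_comm n x y⟩

theorem ext_polar (hn : n.polarBilin.Nondegenerate) {x y : V}
    (h : ∀ z, polar n x z = polar n y z) : x = y := by
  refine sub_eq_zero.1 (hn.1 _ fun z => ?_)
  rw [QuadraticMap.polarBilin_apply_apply, QuadraticMap.polar_sub_left, h, sub_self]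

theorem exists_apply_ne_zero (h0 : n ≠ 0) : ∃ x, n x ≠ 0 := by
  by_contra! h
  exact h0 (QuadraticMap.ext h)

namespace HasMultiplier

theorem one (n : QuadraticForm k V) : HasMultiplier n 1 1 := fun x => (one_mul (n x)).symm

theorem polar_eq (h : HasMultiplier n φ μ) (x y : V) :
    polar n (φ x) (φ y) = μ * polar n x y := by
  simp only [polar, ← map_add, h _]
  ring

theorem polar_apply_right (h : HasMultiplier n φ μ) (x y : V) :
    polar n x (φ y) = μ * polar n (φ.symm x) y := by
  rw [← h.polar_eq, φ.apply_symm_apply]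

theorem mul (h : HasMultiplier n φ μ) (h' : HasMultiplier n ψ ν) :
    HasMultiplier n (φ * ψ) (μ * ν) := fun x => by
  rw [LinearEquiv.mul_apply, h, h', mul_assoc]

theorem unique (h0 : n ≠ 0) (h : HasMultiplier n φ μ) (h' : HasMultiplier n φ ν) : μ = ν := by
  obtain ⟨x, hx⟩ := exists_apply_ne_zero h0
  exact mul_right_cancel₀ hx ((h x).symm.trans (h' x))

theorem ne_zero (h0 : n ≠ 0) (h : HasMultiplier n φ μ) : μ ≠ 0 := by
  obtain ⟨x, hx⟩ := exists_apply_ne_zero h0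
  rintro rfl
  exact hx (by simpa using h (φ.symm x))

theorem inv (h0 : n ≠ 0) (h : HasMultiplier n φ μ) : HasMultiplier n φ⁻¹ μ⁻¹ := fun x => by
  have hx : n x = μ * n (φ⁻¹ x) := by rw [← h]; exact congrArg n (φ.apply_symm_apply x).symm
  rw [hx, inv_mul_cancel_left₀ (h.ne_zero h0)]

end HasMultiplier

section Reflection

/-- The reflection `x ↦ x - n(s)⁻¹ ⟨x, s⟩ s` in the hyperplane orthogonal to a nonsingular vector
`s`; in characteristic two this is the orthogonal transvection along `s`. -/
noncomputable def reflect (n : QuadraticForm k V) (s : V) (hs : n s ≠ 0) : V ≃ₗ[k] V :=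
  Module.reflection (x := s) (f := (n s)⁻¹ • n.polarBilin s) (by
    rw [LinearMap.smul_apply, QuadraticMap.polarBilin_apply_apply, polar_self_eq, smul_eq_mul]
    field_simp)

variable {s : V} (hs : n s ≠ 0)

theorem reflect_apply (x : V) : reflect n s hs x = x - ((n s)⁻¹ * polar n s x) • s :=
  Module.reflection_apply _ _

theorem reflect_inv : (reflect n s hs)⁻¹ = reflect n s hs := rfl

theorem hasMultiplier_reflect : HasMultiplier n (reflect n s hs) 1 := fun x => by
  rw [reflect_apply, map_sub_eq, map_smul_eq, QuadraticMap.polar_smul_right, smul_eq_mul,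
    QuadraticMap.polar_comm n x]
  field_simp
  ring

theorem hasMultiplier_reflect_mul (hσ : HasMultiplier n σ 1) :
    HasMultiplier n (reflect n s hs * σ) 1 := by
  simpa only [mul_one] using (hasMultiplier_reflect hs).mul hσ

theorem reflect_of_polar_eq_zero {x : V} (hx : polar n s x = 0) : reflect n s hs x = x := by
  rw [reflect_apply, hx, mul_zero, zero_smul, sub_zero]

theorem toLinearMap_reflect : (reflect n s hs : V →ₗ[k] V) =
    LinearMap.transvection (-((n s)⁻¹ • n.polarBilin s)) s := by
  ext x
  rw [LinearEquiv.coe_coe, reflect_apply, LinearMap.transvection.apply, LinearMap.neg_apply,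
    neg_smul, sub_eq_add_neg]
  rfl

theorem det_reflect [FiniteDimensional k V] :
    LinearMap.det (reflect n s hs : V →ₗ[k] V) = -1 := by
  rw [toLinearMap_reflect, LinearMap.transvection.det, LinearMap.neg_apply, LinearMap.smul_apply,
    QuadraticMap.polarBilin_apply_apply, polar_self_eq, smul_eq_mul]
  field_simp
  norm_num

theorem reflect_add_reflect_apply {a z : V} (ha : n a ≠ 0) (haz : n (a + z) ≠ 0) (hz : n z = 0)
    (hp : polar n a z = 0) (w : V) :
    reflect n (a + z) haz (reflect n a ha w) =
      w + ((n a)⁻¹ * (polar n a w - polar n z w)) • z - ((n a)⁻¹ * polar n z w) • a := by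
  have h : n (a + z) = n a := by rw [QuadraticMap.map_add n a, hz, hp, add_zero, add_zero]
  simp only [reflect_apply, h, QuadraticMap.polar_add_left, QuadraticMap.polar_sub_right,
    QuadraticMap.polar_smul_right, QuadraticMap.polar_comm n z a, hp, polar_self_eq, smul_eq_mul]
  match_scalars <;> field_simp <;> ring

end Reflection

section OrthogonalComplement

open BilinForm (orthogonal)

theorem mem_orthogonal_polarBilin_iff {W : Submodule k V} {x : V} :
    x ∈ orthogonal n.polarBilin W ↔ ∀ y ∈ W, polar n y x = 0 :=
  BilinForm.mem_orthogonal_iff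

theorem le_orthogonal_of_singular {W : Submodule k V} (hW : ∀ x ∈ W, n x = 0) :
    W ≤ orthogonal n.polarBilin W := fun x hx => mem_orthogonal_polarBilin_iff.2 fun y hy => by
  rw [polar, hW _ (W.add_mem hy hx), hW _ hy, hW _ hx, sub_zero, sub_zero]

variable [FiniteDimensional k V] (hn : n.polarBilin.Nondegenerate)
include hn

theorem exists_polar_eq (f : Module.Dual k V) : ∃ u, ∀ y, polar n u y = f y :=
  ⟨(BilinForm.toDual n.polarBilin hn).symm f, fun y =>
    BilinForm.apply_toDual_symm_apply (B := n.polarBilin) (hB := hn) f y⟩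

theorem orthogonal_orthogonal_polarBilin (W : Submodule k V) :
    orthogonal n.polarBilin (orthogonal n.polarBilin W) = W :=
  BilinForm.orthogonal_orthogonal hn (polarBilin_isSymm n).isRefl W

theorem orthogonal_eq_of_le_of_two_mul_finrank_le {W : Submodule k V}
    (hW : orthogonal n.polarBilin W ≤ W) (hd : 2 * finrank k W ≤ finrank k V) :
    orthogonal n.polarBilin W = W := by
  refine Submodule.eq_of_le_of_finrank_le hW ?_
  have := BilinForm.finrank_orthogonal hn W
  lia

theorem exists_nonsingular_mem_orthogonal {W : Submodule k V} {e : V} (heW : e ∈ W)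
    (he : n e ≠ 0) (hd : 2 * finrank k W ≤ finrank k V) :
    ∃ w ∈ orthogonal n.polarBilin W, n w ≠ 0 := by
  by_contra! h
  have hle := (le_orthogonal_of_singular h).trans_eq (orthogonal_orthogonal_polarBilin hn W)
  have hW := orthogonal_eq_of_le_of_two_mul_finrank_le hn hle hd
  exact he (h e (hW.symm ▸ heW))

theorem exists_polar_ne_zero_mem_orthogonal {W : Submodule k V} {e e' : V} (heW : e ∈ W)
    (heW' : e' ∈ W) (he : polar n e e' ≠ 0) (hd : 2 * finrank k W ≤ finrank k V) :
    ∃ w ∈ orthogonal n.polarBilin W, ∃ w' ∈ orthogonal n.polarBilin W, polar n w w' ≠ 0 := by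
  by_contra! h
  have hle : orthogonal n.polarBilin W ≤ W := fun x hx => orthogonal_orthogonal_polarBilin hn W ▸
    mem_orthogonal_polarBilin_iff.2 fun y hy => h y hy x hx
  have hW := orthogonal_eq_of_le_of_two_mul_finrank_le hn hle hd
  exact he (h e (hW.symm ▸ heW) e' (hW.symm ▸ heW'))

theorem exists_mem_orthogonal_polar_eq_one {W : Submodule k V} {x : V} (hx : x ∉ W) :
    ∃ u ∈ orthogonal n.polarBilin W, polar n u x = 1 := by
  have hx' : ∃ u ∈ orthogonal n.polarBilin W, polar n u x ≠ 0 := by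
    by_contra! h
    exact hx (orthogonal_orthogonal_polarBilin hn W ▸ mem_orthogonal_polarBilin_iff.2 h)
  obtain ⟨u, hu, hux⟩ := hx'
  refine ⟨(polar n u x)⁻¹ • u, Submodule.smul_mem _ _ hu, ?_⟩
  rw [QuadraticMap.polar_smul_left, smul_eq_mul, inv_mul_cancel₀ hux]

end OrthogonalComplement

end QuadraticSpace

section CartanDieudonne

open BilinForm (orthogonal)

variable {k V : Type*} [Field k] [AddCommGroup V] [Module k V] {n : QuadraticForm k V}
  {σ : V ≃ₗ[k] V}

/-- The group generated by the reflections of `(V, n)`. -/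
def reflectionGroup (n : QuadraticForm k V) : Subgroup (V ≃ₗ[k] V) :=
  Subgroup.closure {r | ∃ (s : V) (hs : n s ≠ 0), reflect n s hs = r}

theorem reflect_mul_mem_reflectionGroup {s : V} (hs : n s ≠ 0) :
    reflect n s hs * σ ∈ reflectionGroup n ↔ σ ∈ reflectionGroup n :=
  Subgroup.mul_mem_cancel_left _ (Subgroup.subset_closure ⟨s, hs, rfl⟩)

theorem polar_sub_of_fixed (hσ : HasMultiplier n σ 1) {x : V} (hx : σ x = x) (y : V) :
    polar n x (σ y - y) = 0 := by
  have h := hσ.polar_eq x y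
  rw [hx, one_mul] at h
  rw [QuadraticMap.polar_sub_right, h, sub_self]

theorem polar_apply_of_fixed (hσ : HasMultiplier n σ 1) {x : V} (hx : σ x = x) (y : V) :
    polar n x (σ y) = polar n x y := by
  rw [← sub_eq_zero, ← QuadraticMap.polar_sub_right, polar_sub_of_fixed hσ hx]

theorem reflect_mul_apply_of_fixed (hσ : HasMultiplier n σ 1) {x y : V} (hx : n (σ x - x) ≠ 0)
    (hy : σ y = y) : (reflect n (σ x - x) hx * σ) y = y := by
  rw [LinearEquiv.mul_apply, hy, reflect_of_polar_eq_zero hx]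
  rw [QuadraticMap.polar_comm, polar_sub_of_fixed hσ hy]

theorem fixedSubmodule_lt_reflect_mul (hσ : HasMultiplier n σ 1) {x : V} (hx : n (σ x - x) ≠ 0) :
    σ.toLinearMap.fixedSubmodule < (reflect n (σ x - x) hx * σ).toLinearMap.fixedSubmodule := by
  refine SetLike.lt_iff_le_and_exists.2
    ⟨fun y hy => reflect_mul_apply_of_fixed hσ hx hy, x, ?_, fun h => hx ?_⟩
  · have hp : polar n (σ x - x) (σ x) = n (σ x - x) := by
      rw [map_sub_eq, QuadraticMap.polar_sub_left, polar_self_eq, hσ x, QuadraticMap.polar_comm n x]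
      ring
    change reflect n (σ x - x) hx (σ x) = x
    rw [reflect_apply, hp, inv_mul_cancel₀ hx, one_smul, sub_sub_cancel]
  · have hσx : σ x = x := h
    rw [hσx, sub_self, QuadraticMap.map_zero]

theorem exists_notMem_of_ne_top {R M : Type*} [Ring R] [AddCommGroup M] [Module R M]
    {p q : Submodule R M} (hp : p ≠ ⊤) (hq : q ≠ ⊤) : ∃ y, y ∉ p ∧ y ∉ q := by
  obtain ⟨y, hy⟩ := SetLike.exists_not_mem_of_ne_top p hp rfl
  obtain ⟨z, hz⟩ := SetLike.exists_not_mem_of_ne_top q hq rfl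
  by_cases hyq : y ∈ q
  · by_cases hzp : z ∈ p
    · exact ⟨y + z, fun h => hy ((p.add_mem_iff_left hzp).1 h),
        fun h => hz ((q.add_mem_iff_right hyq).1 h)⟩
    · exact ⟨z, hzp, hz⟩
  · exact ⟨y, hy, hyq⟩

theorem polar_sub_sub_eq_zero (hS : ∀ x, n (σ x - x) = 0) (x y : V) :
    polar n (σ x - x) (σ y - y) = 0 := by
  rw [polar, hS, hS, sub_zero, sub_zero, sub_add_sub_comm, ← map_add, hS]

theorem exists_map_reflect_mul_reflect_sub_ne_zero (hn : n.polarBilin.Nondegenerate)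
    (hσ : HasMultiplier n σ 1) (hS : ∀ x, n (σ x - x) = 0) {a y : V} (ha : n a ≠ 0)
    (hσa : σ a = a) (hs : n (a + (σ y - y)) ≠ 0) (hy : σ y ≠ y) :
    ∃ x, n ((reflect n (a + (σ y - y)) hs * (reflect n a ha * σ)) x - x) ≠ 0 := by
  obtain ⟨w, hw⟩ : ∃ w, polar n (σ y - y) w ≠ 0 := by
    by_contra! h
    exact hy (sub_eq_zero.1 (hn.1 _ h))
  obtain ⟨x, rfl⟩ := σ.surjective w
  refine ⟨x, ?_⟩
  set c := (n a)⁻¹ * polar n (σ y - y) (σ x)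
  set b := (n a)⁻¹ * (polar n a (σ x) - polar n (σ y - y) (σ x))
  have hx : (reflect n (a + (σ y - y)) hs * (reflect n a ha * σ)) x - x =
      ((σ x - x) + b • (σ y - y)) - c • a := by
    rw [LinearEquiv.mul_apply, LinearEquiv.mul_apply,
      reflect_add_reflect_apply ha hs (hS y) (polar_sub_of_fixed hσ hσa y)]
    abel
  have hb : n ((σ x - x) + b • (σ y - y)) = 0 := by
    rw [QuadraticMap.map_add n (σ x - x), map_smul_eq, hS, hS, QuadraticMap.polar_smul_right,
      polar_sub_sub_eq_zero hS, mul_zero, smul_zero, add_zero, add_zero]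
  have hba : polar n ((σ x - x) + b • (σ y - y)) a = 0 := by
    rw [QuadraticMap.polar_comm, QuadraticMap.polar_add_right, QuadraticMap.polar_smul_right,
      polar_sub_of_fixed hσ hσa, polar_sub_of_fixed hσ hσa, smul_zero, add_zero]
  rw [hx, map_sub_eq, hb, QuadraticMap.polar_smul_right, hba, smul_zero, sub_zero, zero_add,
    map_smul_eq]
  exact mul_ne_zero (pow_ne_zero 2 (mul_ne_zero (inv_ne_zero ha) hw)) ha

variable [FiniteDimensional k V]

theorem finrank_fixedSubmodule_le_reflect_mul {s : V} (hs : n s ≠ 0) :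
    finrank k σ.toLinearMap.fixedSubmodule ≤
      1 + finrank k (reflect n s hs * σ).toLinearMap.fixedSubmodule :=
  LinearEquiv.le_one_add_finrank_fixedSubmodule_dilatransvection_mul σ _
    ⟨_, s, toLinearMap_reflect hs⟩

/-- The space orthogonal to the totally singular space `S = {σ x - x}` and to `e` consists of fixed
vectors, and in even dimension it is too large to be totally singular itself. -/
theorem exists_nonsingular_fixed (hn : n.polarBilin.Nondegenerate) (hd : Even (finrank k V))
    {e : V} (he : n e ≠ 0) (hσ : HasMultiplier n σ 1) (hσe : σ e = e)
    (hS : ∀ x, n (σ x - x) = 0) : ∃ a, σ a = a ∧ polar n a e = 0 ∧ n a ≠ 0 := by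
  set S : Submodule k V := LinearMap.range ((σ : V →ₗ[k] V) - 1)
  have hSsing : ∀ x ∈ S, n x = 0 := by
    rintro _ ⟨x, rfl⟩
    exact hS x
  have heS : e ∉ S := fun h => he (hSsing e h)
  have heSo : e ∈ orthogonal n.polarBilin S := mem_orthogonal_polarBilin_iff.2 <| by
    rintro _ ⟨x, rfl⟩
    exact (QuadraticMap.polar_comm _ _ _).trans (polar_sub_of_fixed hσ hσe x)
  have hlt : finrank k S < finrank k (orthogonal n.polarBilin S) :=
    Submodule.finrank_lt_finrank_of_lt <| SetLike.lt_iff_le_and_exists.2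
      ⟨le_orthogonal_of_singular hSsing, e, heSo, heS⟩
  have hrank : 2 * finrank k ↥(S ⊔ Submodule.span k {e}) ≤ finrank k V := by
    rw [Submodule.finrank_sup_span_singleton heS]
    rw [BilinForm.finrank_orthogonal hn] at hlt
    obtain ⟨m, hm⟩ := hd
    lia
  have heX : e ∈ S ⊔ Submodule.span k {e} :=
    Submodule.mem_sup_right (Submodule.mem_span_singleton_self e)
  obtain ⟨a, haX, ha⟩ := exists_nonsingular_mem_orthogonal hn heX he hrank
  rw [mem_orthogonal_polarBilin_iff] at haX
  refine ⟨a, ext_polar hn fun z => ?_, ?_, ha⟩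
  · have hz := haX _ (Submodule.mem_sup_left ⟨σ.symm z, rfl⟩)
    have h := hσ.polar_eq a (σ.symm z)
    rw [LinearMap.sub_apply, LinearEquiv.coe_coe, Module.End.one_apply, σ.apply_symm_apply,
      QuadraticMap.polar_comm, QuadraticMap.polar_sub_right] at hz
    rw [σ.apply_symm_apply] at h
    linear_combination h - hz
  · rw [QuadraticMap.polar_comm, haX e heX]

/-- The reflections are along a fixed vector `a` and along `a + z` with `z = σ y - y` for a `y`
that is scaled so that the second reflection is the one making `y` a fixed vector. -/
theorem exists_reflect_mul_reflect (hn : n.polarBilin.Nondegenerate) (hd : Even (finrank k V))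
    {e : V} (he : n e ≠ 0) (hσ : HasMultiplier n σ 1) (hσe : σ e = e)
    (hS : ∀ x, n (σ x - x) = 0) (hσ1 : σ ≠ 1) :
    ∃ (a s : V) (ha : n a ≠ 0) (hs : n s ≠ 0), polar n a e = 0 ∧ polar n s e = 0 ∧
      finrank k σ.toLinearMap.fixedSubmodule ≤
        finrank k (reflect n s hs * (reflect n a ha * σ)).toLinearMap.fixedSubmodule ∧
      ∃ x, n ((reflect n s hs * (reflect n a ha * σ)) x - x) ≠ 0 := by
  obtain ⟨a, hσa, hae, ha⟩ := exists_nonsingular_fixed hn hd he hσ hσe hS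
  obtain ⟨y, hy, hay⟩ : ∃ y, σ y ≠ y ∧ polar n a y = - n a := by
    have hσ_top : σ.toLinearMap.fixedSubmodule ≠ ⊤ := fun h =>
      hσ1 (LinearEquiv.ext fun x => (h ▸ trivial : x ∈ σ.toLinearMap.fixedSubmodule))
    have ha_top : LinearMap.ker (n.polarBilin a) ≠ ⊤ := fun h => by
      have ha0 : a = 0 := hn.1 a fun y => (h ▸ trivial : y ∈ LinearMap.ker (n.polarBilin a))
      exact ha (by rw [ha0, QuadraticMap.map_zero])
    obtain ⟨y, hy, hay⟩ := exists_notMem_of_ne_top hσ_top ha_top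
    replace hay : polar n a y ≠ 0 := hay
    refine ⟨(-(n a) / polar n a y) • y, fun h => hy ?_, ?_⟩
    · rw [map_smul] at h
      exact smul_right_injective V (div_ne_zero (neg_ne_zero.2 ha) hay) h
    · rw [QuadraticMap.polar_smul_right, smul_eq_mul, div_mul_cancel₀ _ hay]
  have haz : polar n a (σ y - y) = 0 := polar_sub_of_fixed hσ hσa y
  have hs : n (a + (σ y - y)) ≠ 0 := by
    rwa [QuadraticMap.map_add n a, hS, haz, add_zero, add_zero]
  have hτ : (reflect n a ha * σ) y - y = a + (σ y - y) := by
    rw [LinearEquiv.mul_apply, reflect_apply, polar_apply_of_fixed hσ hσa, hay, mul_neg,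
      inv_mul_cancel₀ ha, neg_one_smul]
    abel
  refine ⟨a, a + (σ y - y), ha, hs, hae, ?_, ?_, ?_⟩
  · rw [QuadraticMap.polar_add_left, hae, QuadraticMap.polar_comm, polar_sub_of_fixed hσ hσe,
      add_zero]
  · have hlt := fixedSubmodule_lt_reflect_mul (hasMultiplier_reflect_mul ha hσ) (hτ ▸ hs)
    simp only [hτ] at hlt
    have := Submodule.finrank_lt_finrank_of_lt hlt
    have := finrank_fixedSubmodule_le_reflect_mul (σ := σ) ha
    omega
  · exact exists_map_reflect_mul_reflect_sub_ne_zero hn hσ hS ha hσa hs hy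

theorem mem_reflectionGroup_of_fixed (hn : n.polarBilin.Nondegenerate) (hd : Even (finrank k V))
    {e : V} (he : n e ≠ 0) (hσ : HasMultiplier n σ 1) (hσe : σ e = e) :
    σ ∈ reflectionGroup n := by
  induction hm : finrank k V - finrank k σ.toLinearMap.fixedSubmodule
    using Nat.strong_induction_on generalizing σ with
  | _ m ih =>
    have of_nonsingular {τ : V ≃ₗ[k] V} (hτ : HasMultiplier n τ 1) (hτe : τ e = e)
        (hle : finrank k σ.toLinearMap.fixedSubmodule ≤ finrank k τ.toLinearMap.fixedSubmodule)
        {x : V} (hx : n (τ x - x) ≠ 0) : τ ∈ reflectionGroup n := by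
      have hlt := Submodule.finrank_lt_finrank_of_lt (fixedSubmodule_lt_reflect_mul hτ hx)
      have hfull := Submodule.finrank_le (reflect n _ hx * τ).toLinearMap.fixedSubmodule
      exact (reflect_mul_mem_reflectionGroup hx).1 <| ih _ (by omega)
        (hasMultiplier_reflect_mul hx hτ) (reflect_mul_apply_of_fixed hτ hx hτe) rfl
    by_cases hσ1 : σ = 1
    · exact hσ1 ▸ Subgroup.one_mem _
    by_cases hS : ∀ x, n (σ x - x) = 0
    · obtain ⟨a, s, ha, hs, hae, hse, hle, x, hx⟩ :=
        exists_reflect_mul_reflect hn hd he hσ hσe hS hσ1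
      refine (reflect_mul_mem_reflectionGroup ha).1 <| (reflect_mul_mem_reflectionGroup hs).1 <|
        of_nonsingular (hasMultiplier_reflect_mul hs (hasMultiplier_reflect_mul ha hσ)) ?_ hle hx
      rw [LinearEquiv.mul_apply, LinearEquiv.mul_apply, hσe, reflect_of_polar_eq_zero ha hae,
        reflect_of_polar_eq_zero hs hse]
    · push Not at hS
      obtain ⟨x, hx⟩ := hS
      exact of_nonsingular hσ hσe le_rfl hx

end CartanDieudonne

section AdjointPair

open Polynomial (X C)

theorem charpoly_dualMap {R M : Type*} [CommRing R] [AddCommGroup M] [Module R M]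
    [Module.Free R M] [Module.Finite R M] (f : Module.End R M) :
    LinearMap.charpoly f.dualMap = f.charpoly := by
  classical
  let b := Module.Free.chooseBasis R M
  rw [← LinearMap.charpoly_toMatrix f.dualMap b.dualBasis, ← LinearMap.charpoly_toMatrix f b,
    ← Matrix.charpoly_transpose (LinearMap.toMatrix b b f), ← LinearMap.toMatrix_transpose]
  rfl

theorem charpoly_eq_of_isAdjointPair {k V : Type*} [Field k] [AddCommGroup V] [Module k V]
    [FiniteDimensional k V] {B : BilinForm k V} (hB : B.Nondegenerate) {f g : Module.End k V}
    (h : LinearMap.IsAdjointPair B B f g) : f.charpoly = g.charpoly := by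
  have hconj : (B.toDual hB).conj f = g.dualMap := by
    ext φ y
    obtain ⟨x, rfl⟩ := (B.toDual hB).surjective φ
    rw [LinearEquiv.conj_apply_apply, LinearEquiv.symm_apply_apply]
    exact h x y
  rw [← charpoly_dualMap g, ← hconj, LinearEquiv.charpoly_conj]

theorem charpoly_mul_charpoly_of_add_of_mul {R ι : Type*} [CommRing R] [Fintype ι] [DecidableEq ι]
    {M N : Matrix ι ι R} {t c : R} (hadd : M + N = t • 1) (hmul : M * N = c • 1) :
    M.charpoly * N.charpoly = (X ^ 2 - C t * X + C c) ^ Fintype.card ι := by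
  have hC (r : R) : C.mapMatrix (r • (1 : Matrix ι ι R)) = C r • 1 := by
    rw [← Matrix.map_one C C.map_zero C.map_one]
    exact Matrix.map_smul' C r 1 (map_mul C)
  have hprod : M.charmatrix * N.charmatrix = (X ^ 2 - C t * X + C c) • 1 := by
    have hX : Matrix.scalar ι (X : Polynomial R) = (X : Polynomial R) • 1 :=
      (Matrix.smul_one_eq_diagonal X).symm
    have hadd' := congrArg C.mapMatrix hadd
    have hmul' := congrArg C.mapMatrix hmul
    rw [map_add, hC] at hadd'
    rw [map_mul, hC] at hmul'
    calc M.charmatrix * N.charmatrix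
        = (X ^ 2 : Polynomial R) • 1 - (X : Polynomial R) • (C.mapMatrix M + C.mapMatrix N) +
            C.mapMatrix M * C.mapMatrix N := by
          simp only [Matrix.charmatrix, hX, sub_mul, mul_sub, smul_mul_assoc, mul_smul_comm,
            one_mul, mul_one]
          module
      _ = (X ^ 2 - C t * X + C c) • 1 := by
          rw [hadd', hmul']
          module
  rw [Matrix.charpoly, Matrix.charpoly, ← Matrix.det_mul, hprod, Matrix.det_smul, Matrix.det_one,
    mul_one]

variable {k V : Type*} [Field k] [AddCommGroup V] [Module k V] [FiniteDimensional k V]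

theorem eq_of_monic_of_sq_eq_sq {R : Type*} [CommRing R] [IsDomain R] {p q : Polynomial R}
    (hp : p.Monic) (hq : q.Monic) (h : p ^ 2 = q ^ 2) : p = q := by
  rcases sq_eq_sq_iff_eq_or_eq_neg.1 h with h | h
  · exact h
  · exact Polynomial.eq_of_monic_of_associated hp hq (h ▸ (Associated.refl q).neg_left)

theorem charpoly_eq_of_isAdjointPair_of_add_of_mul {B : BilinForm k V} (hB : B.Nondegenerate)
    {f g : Module.End k V} (h : LinearMap.IsAdjointPair B B f g) {t c : k}
    (hadd : f + g = t • 1) (hmul : f * g = c • 1) (hd : Even (finrank k V)) :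
    f.charpoly = (X ^ 2 - C t * X + C c) ^ (finrank k V / 2) := by
  let b := Module.finBasis k V
  let m := LinearMap.toMatrixAlgEquiv b
  refine eq_of_monic_of_sq_eq_sq f.charpoly_monic (Polynomial.Monic.pow (by monicity!) _) ?_
  have hsq := charpoly_mul_charpoly_of_add_of_mul (M := m f) (N := m g) (t := t) (c := c)
    (by rw [← map_add, hadd, map_smul, map_one]) (by rw [← map_mul, hmul, map_smul, map_one])
  rw [Fintype.card_fin] at hsq
  calc f.charpoly ^ 2 = f.charpoly * g.charpoly := by rw [← charpoly_eq_of_isAdjointPair hB h, sq]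
    _ = (X ^ 2 - C t * X + C c) ^ finrank k V := by
        rw [← hsq]
        exact congrArg₂ _ (LinearMap.charpoly_toMatrix f b).symm
          (LinearMap.charpoly_toMatrix g b).symm
    _ = ((X ^ 2 - C t * X + C c) ^ (finrank k V / 2)) ^ 2 := by
        rw [← pow_mul, Nat.div_mul_cancel hd.two_dvd]

theorem trace_eq_neg_nextCoeff_charpoly (f : Module.End k V) :
    LinearMap.trace k V f = -f.charpoly.nextCoeff := by
  rw [LinearMap.trace_eq_matrix_trace k (Module.finBasis k V),
    Matrix.trace_eq_neg_charpoly_nextCoeff, LinearMap.charpoly_toMatrix]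

theorem trace_eq_of_isAdjointPair {B : BilinForm k V} (hB : B.Nondegenerate)
    {f g : Module.End k V} (h : LinearMap.IsAdjointPair B B f g) :
    LinearMap.trace k V f = LinearMap.trace k V g := by
  rw [trace_eq_neg_nextCoeff_charpoly, charpoly_eq_of_isAdjointPair hB h,
    ← trace_eq_neg_nextCoeff_charpoly]

theorem det_eq_of_isAdjointPair {B : BilinForm k V} (hB : B.Nondegenerate)
    {f g : Module.End k V} (h : LinearMap.IsAdjointPair B B f g) :
    LinearMap.det f = LinearMap.det g := by
  rw [LinearMap.det_eq_sign_charpoly_coeff, charpoly_eq_of_isAdjointPair hB h,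
    ← LinearMap.det_eq_sign_charpoly_coeff]

end AdjointPair

section Dickson

variable {k V : Type*} [Field k] [AddCommGroup V] [Module k V] [FiniteDimensional k V]
  {n : QuadraticForm k V} {φ ψ : V ≃ₗ[k] V}

theorem exists_apply_self_eq (n : QuadraticForm k V) :
    ∃ B : BilinForm k V, (∀ x, B x x = n x) ∧ ∀ x y, polar n x y = B x y + B y x := by
  obtain ⟨B, rfl⟩ := LinearMap.BilinMap.toQuadraticMap_surjective n
  exact ⟨B, fun x => rfl, fun x y => LinearMap.BilinMap.polar_toQuadraticMap x y⟩

theorem exists_end_polar_eq (hn : n.polarBilin.Nondegenerate) (r : BilinForm k V) :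
    ∃ T : Module.End k V, ∀ x y, polar n (T x) y = r x y :=
  ⟨(BilinForm.toDual n.polarBilin hn).symm ∘ₗ r, fun x y =>
    BilinForm.apply_toDual_symm_apply (B := n.polarBilin) (hB := hn) (r x) y⟩

/- Write `B x y = ⟨P x, y⟩` where `B x x = n x`. Then `1 - P` is the adjoint of `P`, so `(1 - P) U`
is the adjoint of `U P` and `tr U - tr (P U) = tr (U P)`. -/
theorem trace_eq_zero_of_polar_symm [CharP k 2] (hn : n.polarBilin.Nondegenerate)
    {U : Module.End k V} (hU : ∀ x y, polar n (U x) y = polar n (U y) x) :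
    LinearMap.trace k V U = 0 := by
  obtain ⟨B, -, hpol⟩ := exists_apply_self_eq n
  obtain ⟨P, hP⟩ := exists_end_polar_eq hn B
  have hadj : LinearMap.IsAdjointPair n.polarBilin n.polarBilin ((1 - P) * U : Module.End k V)
      (U * P : Module.End k V) := fun x y => by
    have hPx : polar n (P (U x)) y = polar n (U x) y - polar n (U x) (P y) := by
      rw [QuadraticMap.polar_comm n (U x) (P y), hP, hP, hpol]
      ring
    simp only [Module.End.mul_apply, LinearMap.sub_apply, Module.End.one_apply,
      QuadraticMap.polarBilin_apply_apply, QuadraticMap.polar_sub_left, hPx, sub_sub_cancel]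
    rw [hU, QuadraticMap.polar_comm]
  have htr := trace_eq_of_isAdjointPair hn hadj
  rw [sub_mul, one_mul, map_sub, LinearMap.trace_mul_comm k P U, sub_eq_iff_eq_add] at htr
  rw [htr, CharTwo.add_self_eq_zero]

theorem exists_eq_sub_of_alternating (hn : n.polarBilin.Nondegenerate) {C : BilinForm k V}
    (hC : C.IsAlt) : ∃ S : Module.End k V, ∀ x y, C x y = polar n (S x) y - polar n (S y) x := by
  let b := Module.finBasis k V
  let r : BilinForm k V :=
    b.constr k fun i => b.constr k fun j => if i < j then C (b i) (b j) else 0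
  have hr (i j) : r (b i) (b j) = if i < j then C (b i) (b j) else 0 := by
    simp only [r, Module.Basis.constr_basis]
  have hCr : C = r - r.flip := LinearMap.ext_basis b b fun i j => by
    rw [LinearMap.sub_apply, LinearMap.sub_apply, BilinForm.flip_apply, hr, hr]
    rcases lt_trichotomy i j with h | rfl | h
    · rw [if_pos h, if_neg h.not_gt, sub_zero]
    · rw [sub_self, hC]
    · rw [if_neg h.not_gt, if_pos h, zero_sub, hC.neg_eq]
  obtain ⟨S, hS⟩ := exists_end_polar_eq hn r
  refine ⟨S, fun x y => ?_⟩
  rw [hS, hS]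
  exact congrArg (fun f : BilinForm k V => f x y) hCr

namespace HasDicksonInvariant

theorem exists_of_form (hn : n.polarBilin.Nondegenerate) (h0 : n ≠ 0) {d μ : k}
    (h : HasDicksonInvariant n φ d) (hμ : HasMultiplier n φ μ) {B : BilinForm k V}
    (hB : ∀ x, B x x = n x) :
    ∃ T : Module.End k V, (∀ x y, B (φ x) (φ y) - μ * B x y =
      polar n (T x) y - polar n (T y) x) ∧ LinearMap.trace k V T = μ * d := by
  obtain ⟨μ', B', T, hμ', hB', hT, htr⟩ := h
  obtain rfl := hμ.unique h0 hμ'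
  have hC : (B - B').IsAlt := fun x => by
    rw [LinearMap.sub_apply, LinearMap.sub_apply, hB, hB', sub_self]
  obtain ⟨S, hS⟩ := exists_eq_sub_of_alternating hn hC
  refine ⟨T + μ • (φ.symm.conj S - S), fun x y => ?_, ?_⟩
  · have hSφ := hS (φ x) (φ y)
    have hSxy := hS x y
    rw [hμ.polar_apply_right, hμ.polar_apply_right] at hSφ
    simp only [LinearMap.sub_apply] at hSφ hSxy
    simp only [LinearMap.add_apply, LinearMap.smul_apply, LinearMap.sub_apply,
      LinearEquiv.conj_apply_apply, LinearEquiv.symm_symm, QuadraticMap.polar_add_left,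
      QuadraticMap.polar_smul_left, QuadraticMap.polar_sub_left, smul_eq_mul]
    linear_combination hSφ - μ * hSxy + hT x y
  · rw [map_add, map_smul, map_sub, LinearMap.trace_conj', sub_self, smul_zero, add_zero, htr]

theorem unique [CharP k 2] (hn : n.polarBilin.Nondegenerate) (h0 : n ≠ 0) {d d' : k}
    (h : HasDicksonInvariant n φ d) (h' : HasDicksonInvariant n φ d') : d = d' := by
  obtain ⟨μ, B, T, hμ, hB, hT, htr⟩ := h
  obtain ⟨T', hT', htr'⟩ := h'.exists_of_form hn h0 hμ hB
  have hsub : LinearMap.trace k V (T - T') = 0 := trace_eq_zero_of_polar_symm hn fun x y => by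
    simp only [LinearMap.sub_apply, QuadraticMap.polar_sub_left]
    linear_combination hT' x y - hT x y
  rw [map_sub, htr, htr', ← mul_sub, mul_eq_zero, sub_eq_zero] at hsub
  exact hsub.resolve_left (hμ.ne_zero h0)

theorem mul (hn : n.polarBilin.Nondegenerate) (h0 : n ≠ 0) {d d' : k}
    (h : HasDicksonInvariant n φ d) (h' : HasDicksonInvariant n ψ d') :
    HasDicksonInvariant n (φ * ψ) (d + d') := by
  obtain ⟨μ, B, T, hμ, hB, hT, htr⟩ := h
  obtain ⟨ν, hν⟩ : ∃ ν, HasMultiplier n ψ ν := h'.imp fun _ ⟨_, _, hν, _⟩ => hν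
  obtain ⟨T', hT', htr'⟩ := h'.exists_of_form hn h0 hν hB
  refine ⟨μ * ν, B, ν • ψ.symm.conj T + μ • T', hμ.mul hν, hB, fun x y => ?_, ?_⟩
  · have hTψ := hT (ψ x) (ψ y)
    rw [hν.polar_apply_right, hν.polar_apply_right] at hTψ
    simp only [LinearMap.add_apply, LinearMap.smul_apply, LinearEquiv.mul_apply,
      LinearEquiv.conj_apply_apply, LinearEquiv.symm_symm, QuadraticMap.polar_add_left,
      QuadraticMap.polar_smul_left, smul_eq_mul]
    linear_combination hTψ + μ * hT' x y
  · rw [map_add, map_smul, map_smul, LinearMap.trace_conj', htr, htr', smul_eq_mul, smul_eq_mul]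
    ring

end HasDicksonInvariant

theorem hasDicksonInvariant_reflect (hn : n.polarBilin.Nondegenerate) {s : V} (hs : n s ≠ 0) :
    HasDicksonInvariant n (reflect n s hs) (-1) := by
  obtain ⟨B, hB, hpol⟩ := exists_apply_self_eq n
  obtain ⟨w, hw⟩ := exists_polar_eq hn (B s)
  refine ⟨1, B, (-(n s)⁻¹ • n.polarBilin s).smulRight w, hasMultiplier_reflect hs, hB,
    fun x y => ?_, ?_⟩
  · simp only [reflect_apply, map_sub, map_smul, LinearMap.sub_apply, LinearMap.smul_apply,
      LinearMap.smulRight_apply, QuadraticMap.polar_smul_left, hw, hB, smul_eq_mul,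
      QuadraticMap.polarBilin_apply_apply]
    rw [hpol s x, hpol s y]
    field_simp
    ring
  · rw [LinearMap.trace_smulRight, LinearMap.smul_apply, QuadraticMap.polarBilin_apply_apply,
      QuadraticMap.polar_comm, hw, hB, smul_eq_mul]
    field_simp

end Dickson

section Parity

variable {k V : Type*} [Field k] [AddCommGroup V] [Module k V] {n : QuadraticForm k V}
  {φ ψ : V ≃ₗ[k] V} {i j : ℕ}

/-- `φ` is a similitude that is proper or improper according to the parity of `i`: its determinant
is `(-1) ^ i * μ(φ) ^ (dim V / 2)` if `char k ≠ 2`, its Dickson invariant is `i` if `char k = 2`. -/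
def HasParity (n : QuadraticForm k V) (φ : V ≃ₗ[k] V) (i : ℕ) : Prop :=
  (ringChar k ≠ 2 → ∃ μ : k, HasMultiplier n φ μ ∧
    LinearMap.det (φ : V →ₗ[k] V) = (-1) ^ i * μ ^ (finrank k V / 2)) ∧
  (ringChar k = 2 → HasDicksonInvariant n φ i)

theorem HasParity.mem_GO (h : HasParity n φ i) : φ ∈ GO n := by
  by_cases hk : ringChar k = 2
  · exact (h.2 hk).imp fun _ ⟨_, _, hμ, _⟩ => hμ
  · exact (h.1 hk).imp fun _ hμ => hμ.1

theorem mem_GOPlus_iff : φ ∈ GOPlus n ↔ HasParity n φ 0 := by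
  have h : φ ∈ GOPlus n ↔ φ ∈ GO n ∧ HasParity n φ 0 := by
    simp only [GOPlus, HasParity, Set.mem_ofPred_eq, pow_zero, one_mul, Nat.cast_zero]
  exact h.trans (and_iff_right_of_imp HasParity.mem_GO)

theorem HasParity.of_even (h : HasParity n φ i) (hi : Even i) : HasParity n φ 0 := by
  refine ⟨fun hk => ?_, fun hk => ?_⟩
  · rw [pow_zero, ← hi.neg_one_pow]
    exact h.1 hk
  · have := ringChar.of_eq hk
    rw [Nat.cast_zero, ← (CharP.cast_eq_zero_iff k 2 i).2 hi.two_dvd]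
    exact h.2 hk

variable [FiniteDimensional k V]

theorem HasParity.mul (hn : n.polarBilin.Nondegenerate) (h0 : n ≠ 0) (hφ : HasParity n φ i)
    (hψ : HasParity n ψ j) : HasParity n (φ * ψ) (i + j) := by
  refine ⟨fun hk => ?_, fun hk => ?_⟩
  · obtain ⟨μ, hμ, hdet⟩ := hφ.1 hk
    obtain ⟨ν, hν, hdet'⟩ := hψ.1 hk
    refine ⟨μ * ν, hμ.mul hν, ?_⟩
    calc LinearMap.det ((φ * ψ : V ≃ₗ[k] V) : V →ₗ[k] V)
        = LinearMap.det (φ : V →ₗ[k] V) * LinearMap.det (ψ : V →ₗ[k] V) :=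
          LinearMap.det_comp (φ : V →ₗ[k] V) (ψ : V →ₗ[k] V)
      _ = (-1) ^ (i + j) * (μ * ν) ^ (finrank k V / 2) := by
          rw [hdet, hdet']
          ring
  · rw [Nat.cast_add]
    exact (hφ.2 hk).mul hn h0 (hψ.2 hk)

theorem hasParity_reflect (hn : n.polarBilin.Nondegenerate) {s : V} (hs : n s ≠ 0) :
    HasParity n (reflect n s hs) 1 := by
  refine ⟨fun _ => ⟨1, hasMultiplier_reflect hs, ?_⟩, fun hk => ?_⟩
  · rw [det_reflect, pow_one, one_pow, mul_one]
  · have := ringChar.of_eq hk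
    rw [Nat.cast_one, ← CharTwo.neg_eq (1 : k)]
    exact hasDicksonInvariant_reflect hn hs

theorem hasParity_one (n : QuadraticForm k V) : HasParity n (1 : V ≃ₗ[k] V) 0 := by
  refine ⟨fun _ => ⟨1, HasMultiplier.one n, ?_⟩, fun _ => ?_⟩
  · rw [pow_zero, one_pow, mul_one]
    exact LinearMap.det_id
  · obtain ⟨B, hB, -⟩ := exists_apply_self_eq n
    refine ⟨1, B, 0, HasMultiplier.one n, hB, fun x y => ?_, ?_⟩
    · simp only [LinearEquiv.coe_one, id_eq, one_mul, sub_self, LinearMap.zero_apply,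
        QuadraticMap.polar_zero_left]
    · rw [map_zero, Nat.cast_zero, mul_zero]

theorem HasParity.even_iff (hn : n.polarBilin.Nondegenerate) (h0 : n ≠ 0) (h : HasParity n φ i)
    (h' : HasParity n φ j) : Even i ↔ Even j := by
  by_cases hk : ringChar k = 2
  · have := ringChar.of_eq hk
    have hij := (h.2 hk).unique hn h0 (h'.2 hk)
    rw [CharP.natCast_eq_natCast k 2] at hij
    rw [Nat.even_iff, Nat.even_iff, hij]
  · obtain ⟨μ, hμ, hdet⟩ := h.1 hk
    obtain ⟨ν, hν, hdet'⟩ := h'.1 hk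
    obtain rfl := hμ.unique h0 hν
    have hij : (-1 : k) ^ i = (-1) ^ j :=
      mul_right_cancel₀ (pow_ne_zero _ (hμ.ne_zero h0)) (hdet.symm.trans hdet')
    have hne : (-1 : k) ≠ 1 := Ring.neg_one_ne_one_of_char_ne_two hk
    rw [← neg_one_pow_eq_one_iff_even hne, ← neg_one_pow_eq_one_iff_even hne, hij]

end Parity

section Hurwitz

variable {k A : Type*} [Field k] [NonAssocRing A] [Module k A] {n : QuadraticForm k A}

/-- The canonical involution `x ↦ ⟨x, 1⟩ 1 - x`. -/
def conj (n : QuadraticForm k A) : A →ₗ[k] A :=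
  (n.polarBilin.flip 1).smulRight 1 - LinearMap.id

theorem conj_apply (n : QuadraticForm k A) (x : A) : conj n x = polar n x 1 • (1 : A) - x := rfl

theorem polar_conj_left (n : QuadraticForm k A) (x y : A) :
    polar n (conj n x) y = polar n x (conj n y) := by
  simp only [conj_apply, QuadraticMap.polar_sub_left, QuadraticMap.polar_smul_left,
    QuadraticMap.polar_sub_right, QuadraticMap.polar_smul_right, smul_eq_mul,
    QuadraticMap.polar_comm n 1 y]
  ring

namespace IsHurwitz

section Norm

variable (hA : IsHurwitz n)
include hA

theorem polarBilin_nondegenerate : n.polarBilin.Nondegenerate :=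
  (polarBilin_isSymm n).isRefl.nondegenerate_iff_separatingLeft.2 hA.nondegenerate

theorem ne_zero : n ≠ 0 := by
  rintro rfl
  have := hA.nontrivial
  exact one_ne_zero (hA.nondegenerate (1 : A) fun y => by simp [polar])

theorem norm_one : n 1 = 1 := by
  obtain ⟨x, hx⟩ := exists_apply_ne_zero hA.ne_zero
  refine mul_right_cancel₀ hx ?_
  rw [← hA.norm_mul, one_mul, one_mul]

theorem norm_one_ne_zero : n 1 ≠ 0 := hA.norm_one.symm ▸ one_ne_zero

theorem polar_one_one : polar n (1 : A) 1 = 2 := by rw [polar_self_eq, hA.norm_one, mul_one]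

theorem polar_mul_mul_left (x y z : A) : polar n (x * y) (x * z) = n x * polar n y z := by
  simp only [polar, ← mul_add, hA.norm_mul]
  ring

theorem polar_mul_mul_right (x y z : A) : polar n (x * z) (y * z) = polar n x y * n z := by
  simp only [polar, ← add_mul, hA.norm_mul]
  ring

theorem polar_mul_mul_add_polar_mul_mul (x y z w : A) :
    polar n (x * y) (z * w) + polar n (z * y) (x * w) = polar n x z * polar n y w := by
  have h := hA.polar_mul_mul_left (x + z) y w
  rw [add_mul, add_mul, QuadraticMap.polar_add_left, QuadraticMap.polar_add_right,
    QuadraticMap.polar_add_right, hA.polar_mul_mul_left, hA.polar_mul_mul_left,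
    QuadraticMap.map_add n] at h
  linear_combination h

theorem conj_conj (x : A) : conj n (conj n x) = x := by
  simp only [conj_apply, QuadraticMap.polar_sub_left, QuadraticMap.polar_smul_left,
    hA.polar_one_one, smul_eq_mul]
  module

theorem norm_conj (x : A) : n (conj n x) = n x := by
  rw [conj_apply, map_sub_eq, map_smul_eq, hA.norm_one, QuadraticMap.polar_smul_left,
    QuadraticMap.polar_comm n 1, smul_eq_mul]
  ring

theorem conj_one : conj n (1 : A) = 1 := by
  rw [conj_apply, hA.polar_one_one]
  module

theorem exists_polar_one_eq_one [FiniteDimensional k A] : ∃ u, polar n u 1 = 1 := by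
  have := hA.nontrivial
  obtain ⟨u, -, hu⟩ := exists_mem_orthogonal_polar_eq_one hA.polarBilin_nondegenerate
    (W := ⊥) (x := 1) (by simp)
  exact ⟨u, hu⟩

end Norm

section LeftAdjoint

variable [IsScalarTower k A A] (hA : IsHurwitz n)
include hA

theorem polar_mul_eq_polar_conj_mul (x y z : A) :
    polar n (x * y) z = polar n y (conj n x * z) := by
  have h := hA.polar_mul_mul_add_polar_mul_mul x y 1 z
  rw [one_mul, one_mul] at h
  rw [conj_apply, sub_mul, smul_mul_assoc, one_mul, QuadraticMap.polar_sub_right,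
    QuadraticMap.polar_smul_right, smul_eq_mul]
  linear_combination h

theorem conj_mul_cancel_left (x y : A) : conj n x * (x * y) = n x • y :=
  ext_polar hA.polarBilin_nondegenerate fun z => by
    rw [QuadraticMap.polar_comm, ← hA.polar_mul_eq_polar_conj_mul, hA.polar_mul_mul_left,
      QuadraticMap.polar_smul_left, smul_eq_mul, QuadraticMap.polar_comm]

theorem mul_conj_cancel_left (x y : A) : x * (conj n x * y) = n x • y := by
  simpa only [hA.conj_conj, hA.norm_conj] using hA.conj_mul_cancel_left (conj n x) y

theorem mul_conj (x : A) : x * conj n x = n x • (1 : A) := by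
  simpa only [mul_one] using hA.mul_conj_cancel_left x 1

theorem mul_conj_add_mul_conj (x y : A) :
    x * conj n y + y * conj n x = polar n x y • (1 : A) := by
  have h := hA.mul_conj (x + y)
  simp only [map_add, add_mul, mul_add, hA.mul_conj, QuadraticMap.map_add n, add_smul] at h
  rw [← sub_eq_zero] at h ⊢
  rw [← h]
  abel

theorem self_mul_self_mul (x z : A) : x * (x * z) = polar n x 1 • (x * z) - n x • z := by
  rw [← hA.conj_mul_cancel_left, conj_apply, sub_mul, smul_mul_assoc, one_mul, sub_sub_cancel]

theorem mul_mul_add_mul_mul (x y z : A) :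
    x * (y * z) + y * (x * z) =
      polar n x 1 • (y * z) + polar n y 1 • (x * z) - polar n x y • z := by
  have h := hA.self_mul_self_mul (x + y) z
  simp only [add_mul, mul_add, QuadraticMap.polar_add_left, QuadraticMap.map_add n, add_smul,
    smul_add, hA.self_mul_self_mul] at h
  rw [← sub_eq_zero] at h ⊢
  rw [← h]
  abel

theorem mul_add_mul (x y : A) :
    x * y + y * x = polar n x 1 • y + polar n y 1 • x - polar n x y • (1 : A) := by
  simpa only [mul_one] using hA.mul_mul_add_mul_mul x y 1

end LeftAdjoint

section RightAdjoint

variable [SMulCommClass k A A] (hA : IsHurwitz n)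
include hA

theorem polar_mul_eq_polar_mul_conj (x y z : A) :
    polar n (y * x) z = polar n y (z * conj n x) := by
  have h := hA.polar_mul_mul_add_polar_mul_mul y x z 1
  rw [mul_one, mul_one, QuadraticMap.polar_comm n (z * x)] at h
  rw [conj_apply, mul_sub, mul_smul_comm, mul_one, QuadraticMap.polar_sub_right,
    QuadraticMap.polar_smul_right, smul_eq_mul]
  linear_combination h

theorem mul_conj_cancel_right (x y : A) : (y * x) * conj n x = n x • y :=
  ext_polar hA.polarBilin_nondegenerate fun z => by
    rw [QuadraticMap.polar_comm, ← hA.polar_mul_eq_polar_mul_conj, hA.polar_mul_mul_right,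
      QuadraticMap.polar_smul_left, smul_eq_mul, QuadraticMap.polar_comm, mul_comm]

theorem conj_mul_cancel_right (x y : A) : (y * conj n x) * x = n x • y := by
  simpa only [hA.conj_conj, hA.norm_conj] using hA.mul_conj_cancel_right (conj n x) y

end RightAdjoint

section Alternativity

variable [IsScalarTower k A A] [SMulCommClass k A A] (hA : IsHurwitz n)
include hA

theorem conj_mul (x y : A) : conj n (x * y) = conj n y * conj n x := by
  have hconj (a w : A) : polar n (conj n a) w = polar n (a * w) 1 := by
    rw [hA.polar_mul_eq_polar_conj_mul, mul_one, QuadraticMap.polar_comm]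
  refine ext_polar hA.polarBilin_nondegenerate fun z => ?_
  calc polar n (conj n (x * y)) z = polar n ((x * y) * z) 1 := hconj _ _
    _ = polar n (x * y) (conj n z) := by rw [hA.polar_mul_eq_polar_mul_conj, one_mul]
    _ = polar n y (conj n x * conj n z) := hA.polar_mul_eq_polar_conj_mul x y _
    _ = polar n (y * z) (conj n x) := by rw [hA.polar_mul_eq_polar_mul_conj]
    _ = polar n z (conj n y * conj n x) := hA.polar_mul_eq_polar_conj_mul y z _
    _ = polar n (conj n y * conj n x) z := QuadraticMap.polar_comm _ _ _

theorem mul_self_eq (x : A) : x * x = polar n x 1 • x - n x • (1 : A) := by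
  rw [← hA.mul_conj, conj_apply, mul_sub, mul_smul_comm, mul_one, sub_sub_cancel]

theorem mul_mul_self (s w : A) :
    (s * w) * s = polar n s (conj n w) • s - n s • conj n w := by
  have h := hA.mul_conj_add_mul_conj s (conj n w)
  rw [hA.conj_conj] at h
  rw [eq_sub_of_add_eq h, sub_mul, smul_mul_assoc, one_mul, hA.conj_mul_cancel_right]

theorem moufang_middle (a x y : A) : (a * x) * (y * a) = (a * (x * y)) * a := by
  refine ext_polar hA.polarBilin_nondegenerate fun z => ?_
  have h := hA.polar_mul_mul_add_polar_mul_mul y a (conj n (a * x)) z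
  have hpol : polar n y (conj n (a * x)) = polar n a (conj n (x * y)) := by
    rw [hA.conj_mul, ← hA.polar_mul_eq_polar_conj_mul, QuadraticMap.polar_comm, polar_conj_left]
  have hconj : polar n (conj n (a * x) * a) (y * z) = n a * polar n (conj n (x * y)) z := by
    rw [hA.conj_mul, hA.conj_mul_cancel_right, QuadraticMap.polar_smul_left, smul_eq_mul,
      hA.conj_mul, hA.polar_mul_eq_polar_conj_mul (conj n y), hA.conj_conj]
  rw [hA.mul_mul_self, hA.polar_mul_eq_polar_conj_mul, QuadraticMap.polar_sub_left,
    QuadraticMap.polar_smul_left, QuadraticMap.polar_smul_left, smul_eq_mul, smul_eq_mul]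
  rw [hpol, hconj] at h
  linear_combination h

theorem moufang_left (a x y : A) : a * (x * (a * y)) = ((a * x) * a) * y := by
  refine ext_polar hA.polarBilin_nondegenerate fun z => ?_
  have h := hA.polar_mul_mul_add_polar_mul_mul x (a * y) (conj n a) z
  rw [hA.conj_mul_cancel_left, ← polar_conj_left, QuadraticMap.polar_smul_left, smul_eq_mul,
    QuadraticMap.polar_comm n (conj n x)] at h
  rw [hA.mul_mul_self, hA.polar_mul_eq_polar_conj_mul a, sub_mul, smul_mul_assoc, smul_mul_assoc,
    QuadraticMap.polar_sub_left, QuadraticMap.polar_smul_left, QuadraticMap.polar_smul_left,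
    smul_eq_mul, smul_eq_mul, hA.polar_mul_eq_polar_conj_mul (conj n x), hA.conj_conj]
  linear_combination h

theorem moufang_right (a x y : A) : ((y * a) * x) * a = y * ((a * x) * a) := by
  have h := congrArg (conj n) (hA.moufang_left (conj n a) (conj n x) (conj n y))
  simp only [hA.conj_mul, hA.conj_conj] at h
  have hflex : a * (x * a) = (a * x) * a := by simpa using hA.moufang_middle a 1 x
  rw [h, hflex]

end Alternativity

end IsHurwitz

end Hurwitz

section LeftMultiplication

variable {k A : Type*} [Field k] [NonAssocRing A] [Module k A] [IsScalarTower k A A]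
  [SMulCommClass k A A] {n : QuadraticForm k A}

theorem mulLeft_add_mulLeft_conj (n : QuadraticForm k A) (a : A) :
    LinearMap.mulLeft k a + LinearMap.mulLeft k (conj n a) = polar n a 1 • 1 := by
  ext x
  simp [conj_apply, sub_mul]

namespace IsHurwitz

variable (hA : IsHurwitz n)
include hA

theorem isAdjointPair_mulLeft (a : A) : LinearMap.IsAdjointPair n.polarBilin n.polarBilin
    (LinearMap.mulLeft k a) (LinearMap.mulLeft k (conj n a)) :=
  hA.polar_mul_eq_polar_conj_mul a

theorem mulLeft_mul_mulLeft_conj (a : A) :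
    LinearMap.mulLeft k a * LinearMap.mulLeft k (conj n a) = n a • 1 := by
  ext x
  exact hA.mul_conj_cancel_left a x

theorem mulLeft_mul_mulLeft_self {a : A} (ha : polar n a 1 = 0) :
    LinearMap.mulLeft k a * LinearMap.mulLeft k a = -n a • 1 := by
  ext x
  simpa [ha] using hA.self_mul_self_mul a x

variable [FiniteDimensional k A]

/-- A skew element `a` of non-zero norm satisfies `det L_a = det L_{-a}`. -/
theorem even_finrank_of_two_ne_zero (h2 : (2 : k) ≠ 0) (hd : 2 ≤ finrank k A) :
    Even (finrank k A) := by
  have := hA.nontrivial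
  obtain ⟨a, ha, hna⟩ := exists_nonsingular_mem_orthogonal hA.polarBilin_nondegenerate
    (Submodule.mem_span_singleton_self (R := k) 1) hA.norm_one_ne_zero
    (by rwa [finrank_span_singleton one_ne_zero])
  have hconj : conj n a = -a := by
    rw [conj_apply, QuadraticMap.polar_comm,
      mem_orthogonal_polarBilin_iff.1 ha 1 (Submodule.mem_span_singleton_self 1), zero_smul,
      zero_sub]
  have hdet : LinearMap.det (LinearMap.mulLeft k a) ≠ 0 := fun h0 => by
    have := congrArg LinearMap.det (hA.mulLeft_mul_mulLeft_conj a)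
    rw [map_mul, h0, zero_mul, LinearMap.det_smul, map_one, mul_one] at this
    exact pow_ne_zero _ hna this.symm
  have hneg : LinearMap.det (LinearMap.mulLeft k a) =
      (-1) ^ finrank k A * LinearMap.det (LinearMap.mulLeft k a) := by
    conv_lhs => rw [det_eq_of_isAdjointPair hA.polarBilin_nondegenerate
      (hA.isAdjointPair_mulLeft a), hconj]
    rw [← LinearMap.det_smul]
    congr 1
    ext x
    simp
  by_contra hodd
  rw [(Nat.not_even_iff_odd.1 hodd).neg_one_pow] at hneg
  refine hdet ((mul_eq_zero.1 ?_).resolve_left h2)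
  linear_combination hneg

/-- If `⟨u, 1⟩ = 1`, then `L_u` and `1 - L_u` have the same trace. -/
theorem even_finrank_of_two_eq_zero (h2 : (2 : k) = 0) : Even (finrank k A) := by
  obtain ⟨u, hu⟩ := hA.exists_polar_one_eq_one
  have htr := congrArg (LinearMap.trace k A) (mulLeft_add_mulLeft_conj n u)
  rw [map_add, ← trace_eq_of_isAdjointPair hA.polarBilin_nondegenerate
    (hA.isAdjointPair_mulLeft u), ← two_mul, h2, zero_mul, hu, one_smul, LinearMap.trace_one] at htr
  have := CharTwo.of_one_ne_zero_of_two_eq_zero one_ne_zero h2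
  exact even_iff_two_dvd.2 ((CharP.cast_eq_zero_iff k 2 _).1 htr.symm)

theorem even_finrank (hd : 2 ≤ finrank k A) : Even (finrank k A) := by
  by_cases h2 : (2 : k) = 0
  · exact hA.even_finrank_of_two_eq_zero h2
  · exact hA.even_finrank_of_two_ne_zero h2 hd

open Polynomial (X C) in
theorem charpoly_mulLeft (hd : Even (finrank k A)) (a : A) : (LinearMap.mulLeft k a).charpoly =
    (X ^ 2 - C (polar n a 1) * X + C (n a)) ^ (finrank k A / 2) :=
  charpoly_eq_of_isAdjointPair_of_add_of_mul hA.polarBilin_nondegenerate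
    (hA.isAdjointPair_mulLeft a) (mulLeft_add_mulLeft_conj n a) (hA.mulLeft_mul_mulLeft_conj a) hd

theorem det_mulLeft (hd : Even (finrank k A)) (a : A) :
    LinearMap.det (LinearMap.mulLeft k a) = n a ^ (finrank k A / 2) := by
  rw [LinearMap.det_eq_sign_charpoly_coeff, hA.charpoly_mulLeft hd, hd.neg_one_pow, one_mul,
    Polynomial.coeff_zero_eq_eval_zero]
  simp

open Polynomial (X C) in
theorem trace_mulLeft (hd : Even (finrank k A)) (a : A) :
    LinearMap.trace k A (LinearMap.mulLeft k a) = (finrank k A / 2 : ℕ) * polar n a 1 := by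
  have hP : (X ^ 2 - C (polar n a 1) * X + C (n a) : Polynomial k).Monic := by monicity!
  have hdeg : (X ^ 2 - C (polar n a 1) * X + C (n a)).natDegree = 2 := by compute_degree!
  rw [trace_eq_neg_nextCoeff_charpoly, hA.charpoly_mulLeft hd, hP.nextCoeff_pow,
    Polynomial.nextCoeff_of_natDegree_pos (by lia), hdeg]
  simp

end IsHurwitz

end LeftMultiplication

section Anticommutation

theorem commute_mul_of_add_eq {R : Type*} [Ring R] {u v z : R} (hv : v * u + u * v = v)
    (hz : z * u + u * z = z) : Commute (v * z) u :=
  calc v * z * u = v * (z - u * z) := by rw [mul_assoc, eq_sub_of_add_eq hz]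
    _ = (v - v * u) * z := by noncomm_ring
    _ = u * (v * z) := by rw [← eq_sub_of_add_eq' hv, mul_assoc]

variable {k R : Type*} [CommRing k] [Ring R] [Algebra k R]

theorem mul_mul_mul_of_add_eq_zero {v w z : R} {c : k} (hv : v * v = c • 1)
    (hw : w * v + v * w = 0) : v * w * (v * z) = -c • (w * z) :=
  calc v * w * (v * z) = v * (w * v) * z := by noncomm_ring
    _ = -(v * v) * (w * z) := by rw [eq_neg_of_add_eq_zero_left hw]; noncomm_ring
    _ = -c • (w * z) := by rw [hv, ← neg_smul, smul_one_mul]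

/-- `u` is, up to a unit, the commutator of `u v w` and `v w'`. -/
theorem trace_eq_zero_of_anticommute {k M : Type*} [Field k] [CharP k 2] [AddCommGroup M]
    [Module k M] {u v w w' : Module.End k M} {c e : k} (hc : c ≠ 0) (he : e ≠ 0)
    (hvv : v * v = c • 1) (hww' : w * w' + w' * w = e • 1) (hvu : v * u + u * v = v)
    (hwu' : w' * u + u * w' = w') (hwv : w * v + v * w = 0)
    (hwv' : w' * v + v * w' = 0) : LinearMap.trace k M u = 0 := by
  have hsub : w * w' - w' * w = e • 1 := by
    rw [← hww', sub_eq_add_neg, ← neg_one_smul k (w' * w), CharTwo.neg_eq, one_smul]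
  have hcomm : u * (v * w) * (v * w') - v * w' * (u * (v * w)) = (-c * e) • u :=
    calc u * (v * w) * (v * w') - v * w' * (u * (v * w))
        = u * (v * w * (v * w') - v * w' * (v * w)) := by
          rw [← mul_assoc (v * w') u, (commute_mul_of_add_eq hvu hwu').eq]
          noncomm_ring
      _ = -c • (u * (w * w' - w' * w)) := by
          rw [mul_mul_mul_of_add_eq_zero hvv hwv, mul_mul_mul_of_add_eq_zero hvv hwv', ← smul_sub,
            mul_smul_comm]
      _ = (-c * e) • u := by rw [hsub, mul_smul_comm, mul_one, smul_smul]
  have htr := congrArg (LinearMap.trace k M) hcomm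
  rw [map_sub, LinearMap.trace_mul_comm, sub_self, map_smul, smul_eq_mul] at htr
  exact (mul_eq_zero.1 htr.symm).resolve_left (mul_ne_zero (neg_ne_zero.2 hc) he)

end Anticommutation

section CharTwoTrace

variable {k A : Type*} [Field k] [NonAssocRing A] [Module k A] {n : QuadraticForm k A}

namespace IsHurwitz

variable (hA : IsHurwitz n)
include hA

section Orthogonal

variable [FiniteDimensional k A]

theorem exists_nonsingular_orthogonal (hd : 4 ≤ finrank k A) (u : A) :
    ∃ v, polar n v 1 = 0 ∧ polar n v u = 0 ∧ n v ≠ 0 := by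
  have hle : (Set.range ![1, u]).finrank k ≤ 2 := finrank_range_le_card _
  have hmem (i) : ![1, u] i ∈ Submodule.span k (Set.range ![1, u]) := Submodule.subset_span ⟨i, rfl⟩
  obtain ⟨v, hv, hnv⟩ := exists_nonsingular_mem_orthogonal hA.polarBilin_nondegenerate
    (hmem 0) hA.norm_one_ne_zero (by rw [Set.finrank] at hle; lia)
  rw [mem_orthogonal_polarBilin_iff] at hv
  exact ⟨v, QuadraticMap.polar_comm n 1 v ▸ hv _ (hmem 0),
    QuadraticMap.polar_comm n u v ▸ hv _ (hmem 1), hnv⟩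

theorem exists_polar_ne_zero_orthogonal (hd : 6 ≤ finrank k A) {u : A} (hu : polar n u 1 ≠ 0)
    (v : A) : ∃ w w', (polar n w 1 = 0 ∧ polar n w u = 0 ∧ polar n w v = 0) ∧
      (polar n w' 1 = 0 ∧ polar n w' u = 0 ∧ polar n w' v = 0) ∧ polar n w w' ≠ 0 := by
  have hle : (Set.range ![1, u, v]).finrank k ≤ 3 := finrank_range_le_card _
  have hmem (i) : ![1, u, v] i ∈ Submodule.span k (Set.range ![1, u, v]) :=
    Submodule.subset_span ⟨i, rfl⟩
  obtain ⟨w, hw, w', hw', hww'⟩ := exists_polar_ne_zero_mem_orthogonal hA.polarBilin_nondegenerate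
    (hmem 1) (hmem 0) hu (by rw [Set.finrank] at hle; lia)
  have horth {x : A} (hx : x ∈ BilinForm.orthogonal n.polarBilin (.span k (Set.range ![1, u, v])))
      (i) : polar n x (![1, u, v] i) = 0 :=
    QuadraticMap.polar_comm n _ x ▸ mem_orthogonal_polarBilin_iff.1 hx _ (hmem i)
  exact ⟨w, w', ⟨horth hw 0, horth hw 1, horth hw 2⟩, ⟨horth hw' 0, horth hw' 1, horth hw' 2⟩, hww'⟩

end Orthogonal

variable [IsScalarTower k A A] [SMulCommClass k A A]

theorem mulLeft_mul_add_mulLeft_mul (x y : A) :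
    LinearMap.mulLeft k x * LinearMap.mulLeft k y + LinearMap.mulLeft k y * LinearMap.mulLeft k x =
      polar n x 1 • LinearMap.mulLeft k y + polar n y 1 • LinearMap.mulLeft k x
        - polar n x y • 1 := by
  ext z
  exact hA.mul_mul_add_mul_mul x y z

theorem mulLeft_mul_add_mulLeft_mul_of_skew {x y : A} (hx : polar n x 1 = 0)
    (hxy : polar n x y = 0) :
    LinearMap.mulLeft k x * LinearMap.mulLeft k y + LinearMap.mulLeft k y * LinearMap.mulLeft k x =
      polar n y 1 • LinearMap.mulLeft k x := by
  rw [hA.mulLeft_mul_add_mulLeft_mul, hx, hxy, zero_smul, zero_smul, zero_add, sub_zero]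

theorem trace_mulLeft_eq_zero [FiniteDimensional k A] [CharP k 2] (hd : 4 ≤ finrank k A) {u : A}
    (hu : polar n u 1 = 1) : LinearMap.trace k A (LinearMap.mulLeft k u) = 0 := by
  have heven := hA.even_finrank (by lia)
  rcases hd.eq_or_lt with h4 | h4
  · rw [hA.trace_mulLeft heven, ← h4]
    simp [CharTwo.two_eq_zero]
  obtain ⟨v, hv1, hvu, hv⟩ := hA.exists_nonsingular_orthogonal hd u
  obtain ⟨w, w', ⟨hw1, -, hwv⟩, ⟨hw1', hwu', hwv'⟩, hww'⟩ :=
    hA.exists_polar_ne_zero_orthogonal (by grind) (hu.symm ▸ one_ne_zero : polar n u 1 ≠ 0) v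
  have hskew {x : A} (hx : polar n x 1 = 0) (hxu : polar n x u = 0) :
      LinearMap.mulLeft k x * LinearMap.mulLeft k u + LinearMap.mulLeft k u * LinearMap.mulLeft k x
        = LinearMap.mulLeft k x := by
    rw [hA.mulLeft_mul_add_mulLeft_mul_of_skew hx hxu, hu, one_smul]
  have hanti {x : A} (hx : polar n x 1 = 0) (hxv : polar n x v = 0) :
      LinearMap.mulLeft k x * LinearMap.mulLeft k v + LinearMap.mulLeft k v * LinearMap.mulLeft k x
        = 0 := by
    rw [hA.mulLeft_mul_add_mulLeft_mul_of_skew hx hxv, hv1, zero_smul]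
  refine trace_eq_zero_of_anticommute (neg_ne_zero.2 hv) (neg_ne_zero.2 hww')
    (hA.mulLeft_mul_mulLeft_self hv1) ?_ (hskew hv1 hvu) (hskew hw1' hwu') (hanti hw1 hwv)
    (hanti hw1' hwv')
  rw [hA.mulLeft_mul_add_mulLeft_mul, hw1, hw1', zero_smul, zero_smul, zero_add, zero_sub, neg_smul]

end IsHurwitz

end CharTwoTrace

section MultiplicationSimilitudes

variable {k A : Type*} [Field k] [NonAssocRing A] [Module k A] {n : QuadraticForm k A}

namespace IsHurwitz

/-- Left multiplication `L_a` by an element of non-zero norm. -/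
noncomputable def mulLeftEquiv [IsScalarTower k A A] [SMulCommClass k A A] (hA : IsHurwitz n)
    (a : A) (ha : n a ≠ 0) : A ≃ₗ[k] A :=
  LinearEquiv.ofLinearMap (LinearMap.mulLeft k a) ((n a)⁻¹ • LinearMap.mulLeft k (conj n a))
    (by ext x; simp [hA.mul_conj_cancel_left, ha]) (by ext x; simp [hA.conj_mul_cancel_left, ha])

/-- Right multiplication `R_a` by an element of non-zero norm. -/
noncomputable def mulRightEquiv [IsScalarTower k A A] [SMulCommClass k A A] (hA : IsHurwitz n)
    (a : A) (ha : n a ≠ 0) : A ≃ₗ[k] A :=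
  LinearEquiv.ofLinearMap (LinearMap.mulRight k a) ((n a)⁻¹ • LinearMap.mulRight k (conj n a))
    (by ext x; simp [hA.conj_mul_cancel_right, ha]) (by ext x; simp [hA.mul_conj_cancel_right, ha])

variable (hA : IsHurwitz n)
include hA

theorem polar_mul_self {u : A} (hu : polar n u 1 = 1) (x : A) : polar n (u * x) x = n x := by
  have h := hA.polar_mul_mul_right u 1 x
  rwa [one_mul, hu, one_mul] at h

theorem exists_polar_one_eq_one_of_notMem_span_one [FiniteDimensional k A] {a : A}
    (hak : a ∉ Submodule.span k {(1 : A)}) : ∃ u, polar n u 1 = 1 ∧ polar n u a = 0 := by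
  have h1 : (1 : A) ∉ Submodule.span k {a} := fun h => by
    obtain ⟨c, hc⟩ := Submodule.mem_span_singleton.1 h
    have := hA.nontrivial
    have hc0 : c ≠ 0 := fun h0 => one_ne_zero (by rw [← hc, h0, zero_smul] : (1 : A) = 0)
    exact hak (Submodule.mem_span_singleton.2 ⟨c⁻¹, by rw [← hc, inv_smul_smul₀ hc0]⟩)
  obtain ⟨u, hu, hu1⟩ := exists_mem_orthogonal_polar_eq_one hA.polarBilin_nondegenerate h1
  exact ⟨u, hu1, QuadraticMap.polar_comm n a u ▸
    mem_orthogonal_polarBilin_iff.1 hu a (Submodule.mem_span_singleton_self a)⟩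

variable [IsScalarTower k A A] [SMulCommClass k A A] {a : A} (ha : n a ≠ 0)

theorem mulLeftEquiv_apply (x : A) : hA.mulLeftEquiv a ha x = a * x := rfl

theorem mulRightEquiv_apply (x : A) : hA.mulRightEquiv a ha x = x * a := rfl

theorem hasMultiplier_mulLeftEquiv : HasMultiplier n (hA.mulLeftEquiv a ha) (n a) :=
  fun x => hA.norm_mul a x

theorem hasDicksonInvariant_mulLeftEquiv_of_trace_eq_zero {u : A} (hu : polar n u 1 = 1)
    {T : Module.End k A} (hT : LinearMap.trace k A T = 0)
    (h : ∀ x y, polar n (u * (a * x)) (a * y) - n a * polar n (u * x) y =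
      polar n (T x) y - polar n (T y) x) : HasDicksonInvariant n (hA.mulLeftEquiv a ha) 0 :=
  ⟨n a, n.polarBilin ∘ₗ LinearMap.mulLeft k u, T, hA.hasMultiplier_mulLeftEquiv ha,
    hA.polar_mul_self hu, h, by rw [hT, mul_zero]⟩

theorem hasDicksonInvariant_mulLeftEquiv_of_polar_one_ne_zero (hat : polar n a 1 ≠ 0) :
    HasDicksonInvariant n (hA.mulLeftEquiv a ha) 0 := by
  refine hA.hasDicksonInvariant_mulLeftEquiv_of_trace_eq_zero ha (u := (polar n a 1)⁻¹ • a) ?_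
    (map_zero _) fun x y => ?_
  · rw [QuadraticMap.polar_smul_left, smul_eq_mul, inv_mul_cancel₀ hat]
  · simp only [smul_mul_assoc, QuadraticMap.polar_smul_left, hA.polar_mul_mul_left,
      LinearMap.zero_apply, QuadraticMap.polar_zero_left, smul_eq_mul]
    ring

variable [FiniteDimensional k A]

theorem hasDicksonInvariant_mulLeftEquiv_of_mem_span_one (hak : a ∈ Submodule.span k {(1 : A)}) :
    HasDicksonInvariant n (hA.mulLeftEquiv a ha) 0 := by
  obtain ⟨c, rfl⟩ := Submodule.mem_span_singleton.1 hak
  obtain ⟨u, hu⟩ := hA.exists_polar_one_eq_one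
  refine hA.hasDicksonInvariant_mulLeftEquiv_of_trace_eq_zero ha hu (map_zero _) fun x y => ?_
  simp only [smul_mul_assoc, one_mul, mul_smul_comm, map_smul_eq, hA.norm_one,
    QuadraticMap.polar_smul_left, QuadraticMap.polar_smul_right, LinearMap.zero_apply,
    QuadraticMap.polar_zero_left, smul_eq_mul]
  ring

theorem hasDicksonInvariant_mulLeftEquiv_of_notMem_span_one [CharP k 2] (hd : 4 ≤ finrank k A)
    (hat : polar n a 1 = 0) (hak : a ∉ Submodule.span k {(1 : A)}) :
    HasDicksonInvariant n (hA.mulLeftEquiv a ha) 0 := by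
  obtain ⟨u, hu, hua⟩ := hA.exists_polar_one_eq_one_of_notMem_span_one hak
  refine hA.hasDicksonInvariant_mulLeftEquiv_of_trace_eq_zero ha hu
    (T := n a • LinearMap.mulLeft k u) ?_ fun x y => ?_
  · rw [map_smul, hA.trace_mulLeft_eq_zero hd hu, smul_zero]
  have hanti : u * (a * x) = a * x - a * (u * x) := by
    have h := hA.mul_mul_add_mul_mul u a x
    rw [hu, hat, hua, one_smul, zero_smul, zero_smul, add_zero, sub_zero] at h
    exact eq_sub_of_add_eq h
  have hadj : polar n (u * y) x = polar n x y - polar n (u * x) y := by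
    rw [hA.polar_mul_eq_polar_conj_mul, conj_apply, hu, one_smul, sub_mul, one_mul,
      QuadraticMap.polar_sub_right, QuadraticMap.polar_comm n y, QuadraticMap.polar_comm n y]
  simp only [hanti, QuadraticMap.polar_sub_left, hA.polar_mul_mul_left, LinearMap.smul_apply,
    LinearMap.mulLeft_apply, QuadraticMap.polar_smul_left, hadj, smul_eq_mul]
  linear_combination (n a * polar n x y - 2 * n a * polar n (u * x) y) *
    (CharTwo.two_eq_zero : (2 : k) = 0)

theorem hasDicksonInvariant_mulLeftEquiv [CharP k 2] (hd : 4 ≤ finrank k A) :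
    HasDicksonInvariant n (hA.mulLeftEquiv a ha) 0 := by
  by_cases hat : polar n a 1 = 0
  · by_cases hak : a ∈ Submodule.span k {(1 : A)}
    · exact hA.hasDicksonInvariant_mulLeftEquiv_of_mem_span_one ha hak
    · exact hA.hasDicksonInvariant_mulLeftEquiv_of_notMem_span_one ha hd hat hak
  · exact hA.hasDicksonInvariant_mulLeftEquiv_of_polar_one_ne_zero ha hat

theorem hasParity_mulLeftEquiv (hd : 4 ≤ finrank k A) : HasParity n (hA.mulLeftEquiv a ha) 0 := by
  refine ⟨fun _ => ⟨n a, hA.hasMultiplier_mulLeftEquiv ha, ?_⟩, fun hk => ?_⟩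
  · rw [pow_zero, one_mul]
    exact hA.det_mulLeft (hA.even_finrank (by lia)) a
  · have := ringChar.of_eq hk
    rw [Nat.cast_zero]
    exact hA.hasDicksonInvariant_mulLeftEquiv ha hd

end IsHurwitz

end MultiplicationSimilitudes

section Autotopy

variable {k A : Type*} [Field k] [NonAssocRing A] [Module k A]

variable (k A) in
/-- The group of linear automorphisms `φ` of `A` that are the first component of an autotopy, that
is, `φ (x y) = φ₁(x) φ₂(y)` for some linear automorphisms `φ₁` and `φ₂`. -/
def autotopy : Subgroup (A ≃ₗ[k] A) where
  carrier := {φ | ∃ φ₁ φ₂ : A ≃ₗ[k] A, ∀ x y, φ (x * y) = φ₁ x * φ₂ y}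
  mul_mem' := by
    rintro φ ψ ⟨φ₁, φ₂, hφ⟩ ⟨ψ₁, ψ₂, hψ⟩
    exact ⟨φ₁ * ψ₁, φ₂ * ψ₂, fun x y => by simp only [LinearEquiv.mul_apply, hψ, hφ]⟩
  one_mem' := ⟨1, 1, fun _ _ => rfl⟩
  inv_mem' := by
    rintro φ ⟨φ₁, φ₂, hφ⟩
    refine ⟨φ₁⁻¹, φ₂⁻¹, fun x y => φ.injective ?_⟩
    rw [hφ]
    exact (φ.apply_symm_apply _).trans
      (congrArg₂ _ (φ₁.apply_symm_apply x).symm (φ₂.apply_symm_apply y).symm)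

variable {n : QuadraticForm k A}

namespace IsHurwitz

variable (hA : IsHurwitz n) {φ φ₁ φ₂ : A ≃ₗ[k] A}

/-- The canonical involution as a linear automorphism. -/
def conjEquiv (hA : IsHurwitz n) : A ≃ₗ[k] A := LinearEquiv.ofInvolutive (conj n) hA.conj_conj

include hA

theorem conjEquiv_apply (x : A) : hA.conjEquiv x = conj n x := rfl

theorem conjEquiv_pow_of_even {i : ℕ} (hi : Even i) : hA.conjEquiv ^ i = 1 := by
  obtain ⟨m, rfl⟩ := hi.two_dvd
  have hsq : hA.conjEquiv ^ 2 = 1 := (sq _).trans (LinearEquiv.ext hA.conj_conj)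
  rw [pow_mul, hsq, one_pow]

theorem norm_map_one_left_ne_zero (h : ∀ x y, φ (x * y) = φ₁ x * φ₂ y) : n (φ₁ 1) ≠ 0 := by
  obtain ⟨y, hy⟩ := φ.surjective 1
  have hmul : n (φ₁ 1) * n (φ₂ y) = 1 := by rw [← hA.norm_mul, ← h, one_mul, hy, hA.norm_one]
  exact left_ne_zero_of_mul_eq_one hmul

theorem norm_map_one_right_ne_zero (h : ∀ x y, φ (x * y) = φ₁ x * φ₂ y) : n (φ₂ 1) ≠ 0 := by
  obtain ⟨x, hx⟩ := φ.surjective 1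
  have hmul : n (φ₁ x) * n (φ₂ 1) = 1 := by rw [← hA.norm_mul, ← h, mul_one, hx, hA.norm_one]
  exact right_ne_zero_of_mul_eq_one hmul

theorem isHurwitz_smul_comp (h : ∀ x y, φ (x * y) = φ₁ x * φ₂ y) :
    IsHurwitz ((n (φ 1))⁻¹ • n.comp (φ : A →ₗ[k] A)) := by
  have h₁ (x : A) : n (φ x) = n (φ₁ x) * n (φ₂ 1) := by rw [← hA.norm_mul, ← h, mul_one]
  have h₂ (y : A) : n (φ y) = n (φ₁ 1) * n (φ₂ y) := by rw [← hA.norm_mul, ← h, one_mul]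
  have ha := hA.norm_map_one_left_ne_zero h
  have hb := hA.norm_map_one_right_ne_zero h
  have hc : n (φ 1) ≠ 0 := h₁ 1 ▸ mul_ne_zero ha hb
  refine ⟨hA.nontrivial, fun x hx => φ.map_eq_zero_iff.1 (hA.nondegenerate _ fun z => ?_),
    fun x y => ?_⟩
  · obtain ⟨y, rfl⟩ := φ.surjective z
    have hxy := hx y
    simp only [polar, smul_apply, QuadraticMap.comp_apply, LinearEquiv.coe_coe,
      smul_eq_mul, ← mul_sub, map_add, mul_eq_zero, inv_eq_zero, hc, false_or] at hxy
    exact hxy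
  · simp only [smul_apply, QuadraticMap.comp_apply, LinearEquiv.coe_coe, smul_eq_mul]
    rw [h, hA.norm_mul, h₁ x, h₂ y, h₁ 1]
    field_simp

theorem norm_smul_one_ne_zero {c : k} (hc : c ≠ 0) : n (c • (1 : A)) ≠ 0 := by
  rw [map_smul_eq, hA.norm_one, mul_one]
  exact pow_ne_zero 2 hc

variable [IsScalarTower k A A] [SMulCommClass k A A]

theorem norm_unique {n' : QuadraticForm k A} (hA' : IsHurwitz n') : n' = n := by
  have := hA.nontrivial
  ext x
  have h := (hA.mul_self_eq x).symm.trans (hA'.mul_self_eq x)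
  by_cases hx : polar n x 1 = polar n' x 1
  · rw [hx, sub_right_inj] at h
    exact (smul_left_injective k (one_ne_zero (α := A)) h).symm
  · have hsmul : (polar n x 1 - polar n' x 1) • x = (n x - n' x) • (1 : A) := by
      rw [sub_smul, sub_smul, sub_eq_sub_iff_sub_eq_sub, h]
    rw [eq_inv_smul_iff₀ (sub_ne_zero.2 hx) |>.2 hsmul, smul_smul, map_smul_eq, map_smul_eq,
      hA.norm_one, hA'.norm_one]

theorem autotopy_mem_GO (hφ : φ ∈ autotopy k A) : φ ∈ GO n := by
  obtain ⟨φ₁, φ₂, h⟩ := hφ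
  have hA' := hA.isHurwitz_smul_comp h
  have hc : n (φ 1) ≠ 0 := fun hc => hA'.ne_zero (by rw [hc, inv_zero, zero_smul])
  refine ⟨n (φ 1), fun x => ?_⟩
  rw [← inv_mul_eq_iff_eq_mul₀ hc, ← DFunLike.congr_fun (hA.norm_unique hA') x]
  rfl

theorem eq_mulRightEquiv_inv_mul (h : ∀ x y, φ (x * y) = φ₁ x * φ₂ y) :
    φ₁ = (hA.mulRightEquiv (φ₂ 1) (hA.norm_map_one_right_ne_zero h))⁻¹ * φ := by
  rw [eq_inv_mul_iff_mul_eq]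
  ext x
  rw [LinearEquiv.mul_apply, mulRightEquiv_apply, ← h, mul_one]

theorem eq_mulLeftEquiv_inv_mul (h : ∀ x y, φ (x * y) = φ₁ x * φ₂ y) :
    φ₂ = (hA.mulLeftEquiv (φ₁ 1) (hA.norm_map_one_left_ne_zero h))⁻¹ * φ := by
  rw [eq_inv_mul_iff_mul_eq]
  ext x
  rw [LinearEquiv.mul_apply, mulLeftEquiv_apply, ← h, one_mul]

theorem mulLeftEquiv_mem_autotopy {a : A} (ha : n a ≠ 0) :
    hA.mulLeftEquiv a ha ∈ autotopy k A := by
  refine ⟨hA.mulRightEquiv a ha * hA.mulLeftEquiv a ha, (hA.mulLeftEquiv a ha)⁻¹, fun x y => ?_⟩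
  obtain ⟨z, rfl⟩ := (hA.mulLeftEquiv a ha).surjective y
  have hz : (hA.mulLeftEquiv a ha)⁻¹ (hA.mulLeftEquiv a ha z) = z :=
    (hA.mulLeftEquiv a ha).symm_apply_apply z
  rw [hz]
  exact hA.moufang_left a x z

theorem mulRightEquiv_mem_autotopy {a : A} (ha : n a ≠ 0) :
    hA.mulRightEquiv a ha ∈ autotopy k A := by
  refine ⟨(hA.mulRightEquiv a ha)⁻¹, hA.mulRightEquiv a ha * hA.mulLeftEquiv a ha, fun x y => ?_⟩
  obtain ⟨z, rfl⟩ := (hA.mulRightEquiv a ha).surjective x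
  have hz : (hA.mulRightEquiv a ha)⁻¹ (hA.mulRightEquiv a ha z) = z :=
    (hA.mulRightEquiv a ha).symm_apply_apply z
  rw [hz]
  exact hA.moufang_right a y z

theorem left_mem_autotopy (hφ : φ ∈ autotopy k A) (h : ∀ x y, φ (x * y) = φ₁ x * φ₂ y) :
    φ₁ ∈ autotopy k A :=
  hA.eq_mulRightEquiv_inv_mul h ▸ mul_mem (inv_mem (hA.mulRightEquiv_mem_autotopy _)) hφ

theorem right_mem_autotopy (hφ : φ ∈ autotopy k A) (h : ∀ x y, φ (x * y) = φ₁ x * φ₂ y) :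
    φ₂ ∈ autotopy k A :=
  hA.eq_mulLeftEquiv_inv_mul h ▸ mul_mem (inv_mem (hA.mulLeftEquiv_mem_autotopy _)) hφ

theorem conjEquiv_mul_mul_mem_autotopy (hφ : φ ∈ autotopy k A) :
    hA.conjEquiv * φ * hA.conjEquiv ∈ autotopy k A := by
  obtain ⟨φ₁, φ₂, h⟩ := hφ
  refine ⟨hA.conjEquiv * φ₂ * hA.conjEquiv, hA.conjEquiv * φ₁ * hA.conjEquiv, fun x y => ?_⟩
  simp only [LinearEquiv.mul_apply, hA.conjEquiv_apply, hA.conj_mul, h]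

theorem reflect_eq {s : A} (hs : n s ≠ 0) :
    reflect n s hs =
      hA.mulLeftEquiv ((-(n s)⁻¹) • 1) (hA.norm_smul_one_ne_zero (neg_ne_zero.2 (inv_ne_zero hs))) *
        hA.mulRightEquiv s hs * hA.mulLeftEquiv s hs * hA.conjEquiv := by
  ext x
  simp only [LinearEquiv.mul_apply, conjEquiv_apply, mulLeftEquiv_apply, mulRightEquiv_apply,
    reflect_apply, hA.mul_mul_self, hA.conj_conj, smul_mul_assoc, one_mul]
  match_scalars <;> field_simp

theorem reflect_mul_mem_autotopy {s : A} (hs : n s ≠ 0) (hφ : φ ∈ autotopy k A) :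
    reflect n s hs * φ * hA.conjEquiv ∈ autotopy k A := by
  rw [hA.reflect_eq, mul_assoc, mul_assoc, ← mul_assoc hA.conjEquiv]
  exact mul_mem (mul_mem (mul_mem (hA.mulLeftEquiv_mem_autotopy _)
    (hA.mulRightEquiv_mem_autotopy _)) (hA.mulLeftEquiv_mem_autotopy _))
    (hA.conjEquiv_mul_mul_mem_autotopy hφ)

end IsHurwitz

end Autotopy

section CanonicalInvolution

variable {k A : Type*} [Field k] [NonAssocRing A] [Module k A] [IsScalarTower k A A]
  [SMulCommClass k A A] {n : QuadraticForm k A}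

theorem mul_comm_of_finrank_le_two [Nontrivial A] [FiniteDimensional k A] (hd : finrank k A ≤ 2)
    (x y : A) : x * y = y * x := by
  by_cases hx : ∃ c : k, c • (1 : A) = x
  · obtain ⟨c, rfl⟩ := hx
    rw [smul_one_mul, mul_smul_one]
  · push Not at hx
    have hli : LinearIndependent k ![1, x] := (LinearIndependent.pair_iff' one_ne_zero).2 hx
    have hcard : Fintype.card (Fin 2) = finrank k A :=
      hli.fintype_card_le_finrank.antisymm (by simpa using hd)
    have hy : y ∈ Submodule.span k {1, x} := by
      rw [← Matrix.range_cons_cons_empty, hli.span_eq_top_of_card_eq_finrank' hcard]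
      exact Submodule.mem_top
    obtain ⟨c, d, rfl⟩ := Submodule.mem_span_pair.1 hy
    simp only [mul_add, add_mul, mul_smul_comm, smul_mul_assoc, one_mul, mul_one]

namespace IsHurwitz

variable (hA : IsHurwitz n)
include hA

theorem mul_mul_cancel_left_of_mul_eq_one {a b : A} (hab : a * b = 1) (x : A) :
    a * (b * x) = x := by
  have ha : n a ≠ 0 :=
    left_ne_zero_of_mul_eq_one (by rw [← hA.norm_mul, hab, hA.norm_one] : n a * n b = 1)
  have hb : n a • b = conj n a := by rw [← hA.conj_mul_cancel_left, hab, mul_one]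
  rw [(eq_inv_smul_iff₀ ha).2 hb, smul_mul_assoc, mul_smul_comm, hA.mul_conj_cancel_left,
    inv_smul_smul₀ ha]

theorem mul_mul_cancel_right_of_mul_eq_one {a b : A} (hab : a * b = 1) (x : A) :
    (x * b) * a = x := by
  have ha : n a ≠ 0 :=
    left_ne_zero_of_mul_eq_one (by rw [← hA.norm_mul, hab, hA.norm_one] : n a * n b = 1)
  have hb : n a • b = conj n a := by rw [← hA.conj_mul_cancel_left, hab, mul_one]
  rw [(eq_inv_smul_iff₀ ha).2 hb, mul_smul_comm, smul_mul_assoc, hA.conj_mul_cancel_right,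
    inv_smul_smul₀ ha]

theorem exists_mul_eq_mul_mul_mul_of_conjEquiv_mem_autotopy (h : hA.conjEquiv ∈ autotopy k A) :
    ∃ a b : A, a * b = 1 ∧ ∀ x y, y * x = (x * a) * (b * y) := by
  obtain ⟨κ₁, κ₂, h⟩ := h
  simp only [conjEquiv_apply] at h
  have hab : κ₁ 1 * κ₂ 1 = 1 := by rw [← h, one_mul, hA.conj_one]
  have hba : κ₂ 1 * κ₁ 1 = 1 := by simpa only [one_mul] using
    hA.mul_mul_cancel_right_of_mul_eq_one hab 1
  have h₁ (x : A) : κ₁ x = conj n x * κ₁ 1 := by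
    rw [← mul_one x, h, hA.mul_mul_cancel_right_of_mul_eq_one hab, mul_one]
  have h₂ (y : A) : κ₂ y = κ₂ 1 * conj n y := by
    rw [← one_mul y, h, hA.mul_mul_cancel_left_of_mul_eq_one hba, one_mul]
  refine ⟨κ₁ 1, κ₂ 1, hab, fun x y => ?_⟩
  have hxy := h (conj n x) (conj n y)
  rwa [hA.conj_mul, h₁, h₂, hA.conj_conj, hA.conj_conj] at hxy

variable [FiniteDimensional k A]

theorem exists_smul_one_eq_of_commute (hd : 4 ≤ finrank k A) {a : A} (h : ∀ x, Commute a x) :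
    ∃ c : k, c • (1 : A) = a := by
  obtain ⟨v, hv1, hva, hv⟩ := hA.exists_nonsingular_orthogonal hd a
  have h2a : (2 : k) • a = polar n a 1 • (1 : A) := by
    refine (hA.mulRightEquiv v hv).injective ?_
    have hav := hA.mul_add_mul a v
    rw [← (h v).eq, hv1, QuadraticMap.polar_comm n a v, hva, zero_smul, zero_smul, add_zero,
      sub_zero] at hav
    rw [mulRightEquiv_apply, mulRightEquiv_apply, smul_mul_assoc, smul_one_mul, two_smul, hav]
  by_cases h2 : (2 : k) = 0
  · have := hA.nontrivial
    obtain ⟨u, hu⟩ := hA.exists_polar_one_eq_one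
    rw [h2, zero_smul, eq_comm, smul_eq_zero_iff_left one_ne_zero] at h2a
    have hau := hA.mul_add_mul a u
    rw [← (h u).eq, ← two_smul k, h2, h2a, hu, zero_smul, zero_smul, zero_add, one_smul, eq_comm,
      sub_eq_zero] at hau
    exact ⟨polar n a u, hau.symm⟩
  · exact ⟨2⁻¹ * polar n a 1, by rw [mul_smul, ← h2a, inv_smul_smul₀ h2]⟩

theorem conjEquiv_notMem_autotopy (hd : 4 ≤ finrank k A) : hA.conjEquiv ∉ autotopy k A := by
  intro h
  obtain ⟨a, b, hab, hmul⟩ := hA.exists_mul_eq_mul_mul_mul_of_conjEquiv_mem_autotopy h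
  have hba : b * a = 1 := by simpa only [one_mul] using
    hA.mul_mul_cancel_right_of_mul_eq_one hab 1
  obtain ⟨c, rfl⟩ := hA.exists_smul_one_eq_of_commute hd (a := a) fun x =>
    (hmul x a).trans (by rw [hba, mul_one])
  have hcomm (x y : A) : y * x = x * y := by
    conv_rhs => rw [← hA.mul_mul_cancel_left_of_mul_eq_one hab y]
    rw [hmul, mul_smul_one, smul_one_mul, mul_smul_comm, smul_mul_assoc]
  have hle : finrank k A ≤ 1 :=
    finrank_le_one 1 fun w => hA.exists_smul_one_eq_of_commute hd fun x => hcomm x w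
  lia

theorem conjEquiv_mem_autotopy (hd : finrank k A ≤ 2) : hA.conjEquiv ∈ autotopy k A := by
  have := hA.nontrivial
  refine ⟨hA.conjEquiv, hA.conjEquiv, fun x y => ?_⟩
  rw [conjEquiv_apply, hA.conj_mul, mul_comm_of_finrank_le_two hd]
  rfl

end IsHurwitz

end CanonicalInvolution

section ProperSimilitudes

variable {k A : Type*} [Field k] [NonAssocRing A] [Module k A] [IsScalarTower k A A]
  [SMulCommClass k A A] {n : QuadraticForm k A}

namespace IsHurwitz

variable [FiniteDimensional k A] (hA : IsHurwitz n) {φ : A ≃ₗ[k] A}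
include hA

theorem mem_reflectionGroup {σ : A ≃ₗ[k] A} (hσ : HasMultiplier n σ 1) (hσ1 : σ 1 = 1) :
    σ ∈ reflectionGroup n := by
  have := hA.nontrivial
  by_cases hd : 2 ≤ finrank k A
  · exact mem_reflectionGroup_of_fixed hA.polarBilin_nondegenerate (hA.even_finrank hd)
      hA.norm_one_ne_zero hσ hσ1
  · have h1 : finrank k A = 1 := by
      have := Module.finrank_pos (R := k) (M := A)
      lia
    suffices σ = 1 from this ▸ one_mem _
    ext x
    obtain ⟨c, rfl⟩ := (finrank_eq_one_iff_of_nonzero' (1 : A) one_ne_zero).1 h1 x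
    rw [map_smul, hσ1, LinearEquiv.coe_one, id_eq]

theorem exists_mulLeftEquiv_mul (hφ : φ ∈ GO n) :
    ∃ (a : A) (ha : n a ≠ 0), ∃ σ ∈ reflectionGroup n, φ = hA.mulLeftEquiv a ha * σ := by
  obtain ⟨μ, hμ⟩ := hφ
  have hμa : n (φ 1) = μ := by rw [hμ, hA.norm_one, mul_one]
  have ha : n (φ 1) ≠ 0 := hμa ▸ hμ.ne_zero hA.ne_zero
  refine ⟨φ 1, ha, _, hA.mem_reflectionGroup ?_ ?_, (mul_inv_cancel_left _ φ).symm⟩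
  · have h := ((hA.hasMultiplier_mulLeftEquiv ha).inv hA.ne_zero).mul hμ
    rwa [← hμa, inv_mul_cancel₀ ha] at h
  · refine (LinearEquiv.symm_apply_eq _).2 ?_
    exact (mul_one _).symm

theorem exists_hasParity_of_mem_reflectionGroup {σ : A ≃ₗ[k] A} (hσ : σ ∈ reflectionGroup n) :
    ∃ i, HasParity n σ i ∧ σ * hA.conjEquiv ^ i ∈ autotopy k A := by
  have hstep {s : A} (hs : n s ≠ 0) {τ : A ≃ₗ[k] A}
      (hτ : ∃ i, HasParity n τ i ∧ τ * hA.conjEquiv ^ i ∈ autotopy k A) :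
      ∃ i, HasParity n (reflect n s hs * τ) i ∧
        reflect n s hs * τ * hA.conjEquiv ^ i ∈ autotopy k A := by
    obtain ⟨i, hi, hmem⟩ := hτ
    refine ⟨1 + i, (hasParity_reflect hA.polarBilin_nondegenerate hs).mul
      hA.polarBilin_nondegenerate hA.ne_zero hi, ?_⟩
    have h := hA.reflect_mul_mem_autotopy hs hmem
    rwa [add_comm 1 i, pow_succ, ← mul_assoc, mul_assoc (reflect n s hs)]
  induction hσ using Subgroup.closure_induction_left with
  | one => exact ⟨0, hasParity_one n, by rw [pow_zero, one_mul]; exact one_mem _⟩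
  | mul_left r hr τ _ ih =>
    obtain ⟨s, hs, rfl⟩ := hr
    exact hstep hs ih
  | inv_mul_cancel r hr τ _ ih =>
    obtain ⟨s, hs, rfl⟩ := hr
    rw [reflect_inv]
    exact hstep hs ih

theorem exists_mul_conjEquiv_pow_mem_autotopy (hφ : φ ∈ GO n) :
    ∃ i, φ * hA.conjEquiv ^ i ∈ autotopy k A := by
  obtain ⟨a, ha, σ, hσ, rfl⟩ := hA.exists_mulLeftEquiv_mul hφ
  obtain ⟨i, -, hmem⟩ := hA.exists_hasParity_of_mem_reflectionGroup hσ
  exact ⟨i, mul_assoc _ σ _ ▸ mul_mem (hA.mulLeftEquiv_mem_autotopy ha) hmem⟩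

theorem exists_hasParity (hd : 4 ≤ finrank k A) (hφ : φ ∈ GO n) :
    ∃ i, HasParity n φ i ∧ φ * hA.conjEquiv ^ i ∈ autotopy k A := by
  obtain ⟨a, ha, σ, hσ, rfl⟩ := hA.exists_mulLeftEquiv_mul hφ
  obtain ⟨i, hi, hmem⟩ := hA.exists_hasParity_of_mem_reflectionGroup hσ
  exact ⟨0 + i, (hA.hasParity_mulLeftEquiv ha hd).mul hA.polarBilin_nondegenerate hA.ne_zero hi,
    by rw [zero_add, mul_assoc]; exact mul_mem (hA.mulLeftEquiv_mem_autotopy ha) hmem⟩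

theorem mem_GO_iff_mem_autotopy (hd : finrank k A ≤ 2) : φ ∈ GO n ↔ φ ∈ autotopy k A := by
  refine ⟨fun hφ => ?_, hA.autotopy_mem_GO⟩
  obtain ⟨i, hmem⟩ := hA.exists_mul_conjEquiv_pow_mem_autotopy hφ
  exact (mul_mem_cancel_right (pow_mem (hA.conjEquiv_mem_autotopy hd) i)).1 hmem

theorem mem_GOPlus_iff_mem_autotopy (hd : 4 ≤ finrank k A) :
    φ ∈ GOPlus n ↔ φ ∈ autotopy k A := by
  refine ⟨fun hφ => ?_, fun hφ => ?_⟩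
  · have hproper := mem_GOPlus_iff.1 hφ
    obtain ⟨i, hi, hmem⟩ := hA.exists_hasParity hd hproper.mem_GO
    have heven : Even i :=
      (hproper.even_iff hA.polarBilin_nondegenerate hA.ne_zero hi).1 Even.zero
    rwa [hA.conjEquiv_pow_of_even heven, mul_one] at hmem
  · obtain ⟨i, hi, hmem⟩ := hA.exists_hasParity hd (hA.autotopy_mem_GO hφ)
    refine mem_GOPlus_iff.2 (hi.of_even (Nat.not_odd_iff_even.1 ?_))
    rintro ⟨m, rfl⟩
    rw [pow_succ, hA.conjEquiv_pow_of_even (even_two_mul m), one_mul,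
      mul_mem_cancel_left hφ] at hmem
    exact hA.conjEquiv_notMem_autotopy hd hmem

theorem finrank_le_two_or : finrank k A ≤ 2 ∨ 4 ≤ finrank k A := by
  by_contra! h
  have heven := hA.even_finrank (by lia)
  rw [show finrank k A = 3 by lia] at heven
  exact absurd heven (by decide)

theorem mem_G_iff_mem_autotopy : φ ∈ G n ↔ φ ∈ autotopy k A := by
  rcases hA.finrank_le_two_or with hd | hd
  · rw [G, if_pos hd, hA.mem_GO_iff_mem_autotopy hd]
  · rw [G, if_neg (by lia), hA.mem_GOPlus_iff_mem_autotopy hd]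

end IsHurwitz

end ProperSimilitudes

section Isotopes

variable {k A : Type*} [Field k] [NonAssocRing A] [Module k A] [IsScalarTower k A A]
  [SMulCommClass k A A] {φ φ₁ φ₂ : A ≃ₗ[k] A}

theorem mem_autotopy_of_mem_Iso {α β γ δ : A ≃ₗ[k] A}
    (h : φ ∈ Iso (isotope α β) (isotope γ δ)) : φ ∈ autotopy k A := by
  refine ⟨γ * φ * α⁻¹, δ * φ * β⁻¹, fun x y => ?_⟩
  obtain ⟨x, rfl⟩ := α.surjective x
  obtain ⟨y, rfl⟩ := β.surjective y
  change φ (α x * β y) = γ (φ (α.symm (α x))) * δ (φ (β.symm (β y)))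
  rw [α.symm_apply_apply, β.symm_apply_apply]
  exact h x y

theorem mem_Iso_isotope (h : ∀ x y, φ (x * y) = φ₁ x * φ₂ y) (α β : A ≃ₗ[k] A) :
    φ ∈ Iso (isotope α β) (isotope (φ₁ * α * φ⁻¹) (φ₂ * β * φ⁻¹)) := by
  intro x y
  change φ (α x * β y) = φ₁ (α (φ.symm (φ x))) * φ₂ (β (φ.symm (φ y)))
  rw [φ.symm_apply_apply, φ.symm_apply_apply, h]

end Isotopes

end HurwitzIsotope

theorem proposition2p4 {k A : Type*} [Field k] [NonAssocRing A] [Module k A]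
    [IsScalarTower k A A] [SMulCommClass k A A] [FiniteDimensional k A]
    (n : QuadraticForm k A) (hA : HurwitzIsotope.IsHurwitz n) :
    -- every element of `G(A)` has triality components, and these can be taken in `G(A)`
    (∀ φ ∈ HurwitzIsotope.G n, ∃ φ₁ ∈ HurwitzIsotope.G n, ∃ φ₂ ∈ HurwitzIsotope.G n,
      HurwitzIsotope.IsTriality n φ φ₁ φ₂) ∧
    -- for any choice of triality components, `φ` is an isomorphism of the stated isotopes;
    -- `R` and `L` are the (invertible) multiplications by `φ₂(1)` and `φ₁(1)`
    (∀ φ ∈ HurwitzIsotope.G n, ∀ φ₁ φ₂ : A ≃ₗ[k] A, HurwitzIsotope.IsTriality n φ φ₁ φ₂ →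
      ∃ R L : A ≃ₗ[k] A,
        (R : A →ₗ[k] A) = LinearMap.mulRight k (φ₂ 1) ∧
        (L : A →ₗ[k] A) = LinearMap.mulLeft k (φ₁ 1) ∧
        φ₁ = R⁻¹ * φ ∧ φ₂ = L⁻¹ * φ ∧
        ∀ α β : A ≃ₗ[k] A,
          φ₁ * α * φ⁻¹ = R⁻¹ * φ * α * φ⁻¹ ∧
          φ₂ * β * φ⁻¹ = L⁻¹ * φ * β * φ⁻¹ ∧
          φ ∈ HurwitzIsotope.Iso (HurwitzIsotope.isotope α β)
            (HurwitzIsotope.isotope (φ₁ * α * φ⁻¹) (φ₂ * β * φ⁻¹))) ∧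
    -- every isomorphism between principal isotopes lies in `G(A)`
    (∀ α β γ δ : A ≃ₗ[k] A,
      HurwitzIsotope.Iso (HurwitzIsotope.isotope α β) (HurwitzIsotope.isotope γ δ) ⊆
        HurwitzIsotope.G n) ∧
    -- for `dim A ≥ 4`, no improper similitude is such an isomorphism
    (4 ≤ Module.finrank k A → ∀ φ ∈ HurwitzIsotope.GO n \ HurwitzIsotope.GOPlus n,
      ∀ α β γ δ : A ≃ₗ[k] A,
        φ ∉ HurwitzIsotope.Iso (HurwitzIsotope.isotope α β)
          (HurwitzIsotope.isotope γ δ)) := by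
  refine ⟨fun φ hφ => ?_, fun φ _ φ₁ φ₂ ⟨_, _, h⟩ => ?_, fun α β γ δ φ hφ => ?_,
    fun hd φ hφ α β γ δ h => ?_⟩
  · have hφ' := hA.mem_G_iff_mem_autotopy.1 hφ
    obtain ⟨φ₁, φ₂, h⟩ := hA.mem_G_iff_mem_autotopy.1 hφ
    have h₁ := hA.left_mem_autotopy hφ' h
    have h₂ := hA.right_mem_autotopy hφ' h
    exact ⟨φ₁, hA.mem_G_iff_mem_autotopy.2 h₁, φ₂, hA.mem_G_iff_mem_autotopy.2 h₂,
      hA.autotopy_mem_GO h₁, hA.autotopy_mem_GO h₂, h⟩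
  · have h₁ := hA.eq_mulRightEquiv_inv_mul h
    have h₂ := hA.eq_mulLeftEquiv_inv_mul h
    exact ⟨hA.mulRightEquiv (φ₂ 1) _, hA.mulLeftEquiv (φ₁ 1) _, rfl, rfl, h₁, h₂, fun α β =>
      ⟨congrArg (· * α * φ⁻¹) h₁, congrArg (· * β * φ⁻¹) h₂,
        HurwitzIsotope.mem_Iso_isotope h α β⟩⟩
  · exact hA.mem_G_iff_mem_autotopy.2 (HurwitzIsotope.mem_autotopy_of_mem_Iso hφ)
  · exact hφ.2 ((hA.mem_GOPlus_iff_mem_autotopy hd).2 (HurwitzIsotope.mem_autotopy_of_mem_Iso h))
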